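/- For each $n\ge 1$ let $(X^{(n)}_t)_{t=0,1,2,\dots}$ be a discrete-time Markov chain on $\{0,1,\dots,N_n\}$, $N_n\ge 1$, with transition kernel $P_n$, that is an irreducible birth-and-death chain ($P_n(x,y)=0$ whenever $|x-y|>1$) and lazy ($P_n(x,x)\ge \frac12$ for all $x$). Let $\pi_n$ be its stationary distribution, $d_n(t)=\max_x \|P_n^t(x,\cdot)-\pi_n\|_{\mathrm{TV}}$, $t^{(n)}_{\mathrm{mix}}(\epsilon)=\min\{t\in\{0,1,2,\dots\}: d_n(t)\le \epsilon\}$ for $0<\epsilon<1$, and $t^{(n)}_{\mathrm{mix}}=t^{(n)}_{\mathrm{mix}}(\frac14)$. Let $\mathrm{gap}(n)=1-\lambda_n$, where $\lambda_n$ is the largest absolute value of an eigenvalue of $P_n$ other than the trivial eigenvalue $1$, and let $t^{(n)}_{\mathrm{rel}}=1/\mathrm{gap}(n)$. Then the sequence exhibits total-variation cutoff, i.e. $\lim_{n\to\infty} t^{(n)}_{\mathrm{mix}}(\epsilon)/t^{(n)}_{\mathrm{mix}}(1-\epsilon)=1$ for every $0<\epsilon<1$, if and only if $t^{(n)}_{\mathrm{mix}}\cdot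 \mathrm{gap}(n)\to\infty$ as $n\to\infty$. Furthermore, if the sequence exhibits cutoff, then $w_n=\sqrt{t^{(n)}_{\mathrm{mix}}\cdot t^{(n)}_{\mathrm{rel}}}$ is a cutoff window for it: $w_n=o\big(t^{(n)}_{\mathrm{mix}}\big)$, and for every $0<\epsilon<1$ there is $c_\epsilon>0$ such that $t^{(n)}_{\mathrm{mix}}(\epsilon)-t^{(n)}_{\mathrm{mix}}(1-\epsilon)\le c_\epsilon w_n$ for all $n$. -/

import Mathlib

open Filter Topology Asymptotics

noncomputable section

namespace BDChain

/-- `P` is the transition kernel of a birth-and-death chain on `{0, …, N}`: a stochastic matrix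
that charges only pairs of states at distance at most one. -/
structure IsBirthDeath {N : ℕ} (P : Matrix (Fin (N + 1)) (Fin (N + 1)) ℝ) : Prop where
  stochastic : P ∈ Matrix.rowStochastic ℝ (Fin (N + 1))
  nearest : ∀ x y : Fin (N + 1), (x : ℕ) + 1 < y ∨ (y : ℕ) + 1 < x → P x y = 0

variable {Ω : Type*} [Fintype Ω] [DecidableEq Ω]

/-- A chain is lazy if it stays in place with probability at least `1 / 2` at every state. -/
def IsLazy (P : Matrix Ω Ω ℝ) : Prop := ∀ x, 1 / 2 ≤ P x x

/-- `p` is a stationary distribution of the chain with transition kernel `P`. -/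
def IsStationary (P : Matrix Ω Ω ℝ) (p : Ω → ℝ) : Prop :=
  p ∈ stdSimplex ℝ Ω ∧ Matrix.vecMul p P = p

/-- Total-variation distance of two distributions on a finite space. -/
def tv (μ ν : Ω → ℝ) : ℝ := 1 / 2 * ∑ x, |μ x - ν x|

/-- Worst-case total-variation distance from `p` at time `t`; the law of the chain at time `t`
started from `x` is the row `(P ^ t) x`. -/
def worstDist (P : Matrix Ω Ω ℝ) (p : Ω → ℝ) (t : ℕ) : ℝ := ⨆ x, tv ((P ^ t) x) p

/-- Mixing time: the least `t` with `worstDist P p t ≤ ε`. -/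
def tmix (P : Matrix Ω Ω ℝ) (p : Ω → ℝ) (ε : ℝ) : ℕ := sInf {t | worstDist P p t ≤ ε}

/-- The largest absolute value of a nontrivial eigenvalue. The eigenvalue `1` of an irreducible
kernel is simple, and an irreducible birth-and-death kernel, being reversible, has only real
eigenvalues. -/
def lam (P : Matrix Ω Ω ℝ) : ℝ :=
  sSup {r | ∃ μ : ℝ, Module.End.HasEigenvalue (Matrix.toLin' P) μ ∧ μ ≠ 1 ∧ r = |μ|}

/-- Spectral gap. -/
def gap (P : Matrix Ω Ω ℝ) : ℝ := 1 - lam P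

/-- Relaxation time. -/
def trel (P : Matrix Ω Ω ℝ) : ℝ := (gap P)⁻¹

/-- Total-variation cutoff, for a family of chains with mixing times `T n ε`. -/
def HasCutoff (T : ℕ → ℝ → ℕ) : Prop :=
  ∀ ε : ℝ, 0 < ε → ε < 1 →
    Tendsto (fun n => (T n ε : ℝ) / (T n (1 - ε) : ℝ)) atTop (𝓝 1)

/-- `w` is a cutoff window, for a family of chains with mixing times `T n ε`. -/
def IsCutoffWindow (T : ℕ → ℝ → ℕ) (w : ℕ → ℝ) : Prop :=
  w =o[atTop] (fun n => (T n (1 / 4) : ℝ)) ∧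
    ∀ ε : ℝ, 0 < ε → ε < 1 →
      ∃ c : ℝ, 0 < c ∧ ∀ n, (T n ε : ℝ) - (T n (1 - ε) : ℝ) ≤ c * w n

end BDChain

end

namespace BDChain

/-! Let M(x) be the mean passage time from 0 to x. The easy direction is spectral: a nontrivial
eigenvalue λ forces |λ|^t ≤ 2 d(t). If `tmix * gap` stayed below a constant C along a subsequence,
cutoff would give tmix(ε) < 2 tmix(1 - ε) ≤ 2 tmix(1/4), so at time tmix(ε) the distance would still
be of order exp(-4C). Choosing ε below that order contradicts the definition of tmix(ε).

For the converse and the window it is enough to bound the width of the mixing profile, tmix(ε) -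
tmix(1 - ε) ≤ c √(tmix · trel) with c depending only on ε (`exists_tmix_sub_le`), since √(tmix ·
trel) / tmix = (tmix · gap)^(-1/2). Three facts carry this.

Reduction to the endpoints (`Rates.sum_posPart_le`). Laziness makes the step operator preserve
unimodality, so by reversibility the set where P^t(x, ·) exceeds π is an interval [a, b]. Its
indicator is 1_{≤ b} + 1_{≥ a} - 1, and monotonicity bounds the two half-line terms by their values
for the chains started at 0 and at N. The reflection x ↦ N - x then leaves only the chain started at
0.

Concentration of passage times. An explicit quadratic function of position and time
(`Rates.passQuad`) is a supermartingale up to the passage to l, which gives Chebyshev bounds on both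
sides of M(l) without constructing the process. Testing the Poincaré inequality on mean passage
times (`Rates.edgeVar_le`) bounds the variance by O(trel · M(l)), provided l is not beyond the (1 -
ε)-quantile of π.

Closeness of quantiles (`Rates.passMean_sub_le`). The Poincaré inequality for M truncated between
the ε- and (1 - ε)-quantiles shows that their mean passage times differ by O(trel).

Before M(ε-quantile) minus O(√(M · trel)) the chain from 0 has missed almost all of π; once O(√(M ·
trel)) past M((1 - ε)-quantile) its contribution to the distance is small. The two times differ by
O(trel + √(M · trel)), and M = O(tmix), trel ≤ 2 tmix. -/

/-- Edge rates of a lazy birth-and-death chain on `{0, …, N}` that is reversible with respect to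
the probability weights `w`; `u` and `d` are the up and down probabilities. -/
structure Rates (N : ℕ) (w u d : ℕ → ℝ) : Prop where
  w_pos : ∀ x ≤ N, 0 < w x
  sum_w : ∑ x ∈ Finset.range (N + 1), w x = 1
  u_pos : ∀ x < N, 0 < u x
  u_top : u N = 0
  d_zero : d 0 = 0
  lazy : ∀ x ≤ N, u x + d x ≤ 1 / 2
  balance : ∀ x < N, w x * u x = w (x + 1) * d (x + 1)

/-- One step of the chain, acting on functions. -/
noncomputable def step (u d f : ℕ → ℝ) (x : ℕ) : ℝ :=
  f x + u x * (f (x + 1) - f x) + d x * (f (x - 1) - f x)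

/-- Mass of `{0, …, j}`. -/
noncomputable def cum (w : ℕ → ℝ) (j : ℕ) : ℝ := ∑ i ∈ Finset.range (j + 1), w i

/-- Mean passage time from `j` to `j + 1`. -/
noncomputable def edgeMean (w u : ℕ → ℝ) (j : ℕ) : ℝ := cum w j / (w j * u j)

/-- Mean passage time from `0` to `x`. -/
noncomputable def passMean (w u : ℕ → ℝ) (x : ℕ) : ℝ := ∑ j ∈ Finset.range x, edgeMean w u j

/-- An upper bound for the variance of the passage time from `j` to `j + 1`. -/
noncomputable def edgeVar (w u : ℕ → ℝ) (j : ℕ) : ℝ :=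
  (2 * ∑ i ∈ Finset.range j, w i * u i * edgeMean w u i ^ 2 + w j * u j * edgeMean w u j ^ 2)
    / (w j * u j)

/-- An upper bound for the variance of the passage time from `0` to `x`. -/
noncomputable def passVar (w u : ℕ → ℝ) (x : ℕ) : ℝ := ∑ j ∈ Finset.range x, edgeVar w u j

/-- The Poincaré inequality with constant `γ`. -/
def Poincare (N : ℕ) (w u : ℕ → ℝ) (γ : ℝ) : Prop :=
  ∀ f : ℕ → ℝ, γ * (∑ x ∈ Finset.range (N + 1), w x * f x ^ 2
      - (∑ x ∈ Finset.range (N + 1), w x * f x) ^ 2)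
    ≤ ∑ j ∈ Finset.range N, w j * u j * (f (j + 1) - f j) ^ 2

namespace Rates

variable {N : ℕ} {w u d : ℕ → ℝ}

/-! ### Signs, reflection and monotonicity of the basic quantities. -/

lemma u_nonneg (h : Rates N w u d) {x : ℕ} (hx : x ≤ N) : 0 ≤ u x := by
  rcases hx.lt_or_eq with hx | rfl
  · exact (h.u_pos x hx).le
  · exact h.u_top.ge

lemma d_pos (h : Rates N w u d) {x : ℕ} (hx : x < N) : 0 < d (x + 1) := by
  have h1 := mul_pos (h.w_pos x hx.le) (h.u_pos x hx)
  rw [h.balance x hx] at h1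
  exact pos_of_mul_pos_right h1 (h.w_pos _ hx).le

lemma d_nonneg (h : Rates N w u d) {x : ℕ} (hx : x ≤ N) : 0 ≤ d x := by
  rcases x with _ | x
  · exact h.d_zero.ge
  · exact (h.d_pos hx).le

lemma reflect (h : Rates N w u d) :
    Rates N (fun x => w (N - x)) (fun x => d (N - x)) (fun x => u (N - x)) where
  w_pos x _ := h.w_pos _ (by omega)
  sum_w := by
    rw [← h.sum_w, ← Finset.sum_range_reflect w (N + 1)]
    simp
  u_pos x hx := by
    have := h.d_pos (x := N - x - 1) (by omega)
    rwa [show N - x - 1 + 1 = N - x by omega] at this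
  u_top := by simpa using h.d_zero
  d_zero := by simpa using h.u_top
  lazy x _ := by linarith [h.lazy (N - x) (by omega)]
  balance x hx := by
    have := h.balance (N - (x + 1)) (by omega)
    rw [show N - (x + 1) + 1 = N - x by omega] at this
    exact this.symm

lemma cum_pos (h : Rates N w u d) {j : ℕ} (hj : j ≤ N) : 0 < cum w j :=
  Finset.sum_pos (fun i hi => h.w_pos i (by simp at hi; omega)) ⟨0, by simp⟩

lemma cum_mono (h : Rates N w u d) {i j : ℕ} (hij : i ≤ j) (hj : j ≤ N) : cum w i ≤ cum w j :=
  Finset.sum_le_sum_of_subset_of_nonneg (by simpa using hij)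
    (fun k hk _ => (h.w_pos k (by simp at hk; omega)).le)

lemma cum_top (h : Rates N w u d) : cum w N = 1 := h.sum_w

lemma cum_le_one (h : Rates N w u d) {j : ℕ} (hj : j ≤ N) : cum w j ≤ 1 :=
  h.cum_top ▸ h.cum_mono hj le_rfl

lemma edge_pos (h : Rates N w u d) {j : ℕ} (hj : j < N) : 0 < w j * u j :=
  mul_pos (h.w_pos j hj.le) (h.u_pos j hj)

lemma edgeMean_pos (h : Rates N w u d) {j : ℕ} (hj : j < N) : 0 < edgeMean w u j :=
  div_pos (h.cum_pos hj.le) (h.edge_pos hj)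

lemma edge_mul_edgeMean (h : Rates N w u d) {j : ℕ} (hj : j < N) :
    w j * u j * edgeMean w u j = cum w j := mul_div_cancel₀ _ (h.edge_pos hj).ne'

lemma edge_mul_edgeVar (h : Rates N w u d) {j : ℕ} (hj : j < N) :
    w j * u j * edgeVar w u j =
      2 * ∑ i ∈ Finset.range j, w i * u i * edgeMean w u i ^ 2 + w j * u j * edgeMean w u j ^ 2 :=
  mul_div_cancel₀ _ (h.edge_pos hj).ne'

lemma edgeVar_nonneg (h : Rates N w u d) {j : ℕ} (hj : j < N) : 0 ≤ edgeVar w u j := by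
  refine div_nonneg (add_nonneg (mul_nonneg two_pos.le (Finset.sum_nonneg fun i hi => ?_)) ?_)
    (h.edge_pos hj).le
  · exact mul_nonneg (h.edge_pos (by simp at hi; omega)).le (sq_nonneg _)
  · exact mul_nonneg (h.edge_pos hj).le (sq_nonneg _)

lemma passMean_mono (h : Rates N w u d) {i j : ℕ} (hij : i ≤ j) (hj : j ≤ N) :
    passMean w u i ≤ passMean w u j :=
  Finset.sum_le_sum_of_subset_of_nonneg (by simpa using hij)
    (fun k hk _ => (h.edgeMean_pos (by simp at hk; omega)).le)

lemma passVar_mono (h : Rates N w u d) {i j : ℕ} (hij : i ≤ j) (hj : j ≤ N) :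
    passVar w u i ≤ passVar w u j :=
  Finset.sum_le_sum_of_subset_of_nonneg (by simpa using hij)
    (fun k hk _ => h.edgeVar_nonneg (by simp at hk; omega))

/-! ### Positivity and linearity of the step operator -/

lemma step_add (f g : ℕ → ℝ) : step u d (f + g) = step u d f + step u d g := by
  ext x; simp only [step, Pi.add_apply]; ring

lemma step_const (a : ℝ) : step u d (fun _ => a) = fun _ => a := by
  ext x; simp [step]

lemma iterate_add (t : ℕ) (f g : ℕ → ℝ) :
    (step u d)^[t] (f + g) = (step u d)^[t] f + (step u d)^[t] g := by
  induction t generalizing f g with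
  | zero => rfl
  | succ t ih => simp only [Function.iterate_succ, Function.comp, step_add, ih]

lemma iterate_const (t : ℕ) (a : ℝ) : (step u d)^[t] (fun _ => a) = fun _ => a :=
  Function.iterate_fixed (step_const a) t

lemma step_congr (h : Rates N w u d) {f g : ℕ → ℝ} (hfg : ∀ x ≤ N, f x = g x) {x : ℕ}
    (hx : x ≤ N) : step u d f x = step u d g x := by
  rcases hx.lt_or_eq with hx' | rfl
  · simp only [step, hfg x hx, hfg (x - 1) (by omega), hfg (x + 1) hx']
  · simp only [step, hfg x hx, hfg (x - 1) (by omega), h.u_top, zero_mul]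

lemma iterate_congr (h : Rates N w u d) (t : ℕ) {f g : ℕ → ℝ} (hfg : ∀ x ≤ N, f x = g x) :
    ∀ x ≤ N, (step u d)^[t] f x = (step u d)^[t] g x := by
  induction t generalizing f g with
  | zero => exact hfg
  | succ t ih => exact ih fun x hx => h.step_congr hfg hx

/-- Monotonicity of the step at a point, restricted to the neighbours it sees. -/
lemma step_le_step (h : Rates N w u d) {f g : ℕ → ℝ} {x : ℕ} (hx : x ≤ N) (h0 : f x ≤ g x)
    (h1 : x < N → f (x + 1) ≤ g (x + 1)) (h2 : f (x - 1) ≤ g (x - 1)) :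
    step u d f x ≤ step u d g x := by
  have hl := h.lazy x hx
  have hu := h.u_nonneg hx
  have hd := h.d_nonneg hx
  have e1 : u x * f (x + 1) ≤ u x * g (x + 1) := by
    rcases hx.lt_or_eq with hx' | rfl
    · exact mul_le_mul_of_nonneg_left (h1 hx') hu
    · simp [h.u_top]
  have e2 := mul_le_mul_of_nonneg_left h2 hd
  have e3 := mul_le_mul_of_nonneg_left h0 (show 0 ≤ 1 - u x - d x by linarith)
  simp only [step]
  linarith

lemma iterate_le_iterate (h : Rates N w u d) (t : ℕ) {f g : ℕ → ℝ} (hfg : ∀ x ≤ N, f x ≤ g x) :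
    ∀ x ≤ N, (step u d)^[t] f x ≤ (step u d)^[t] g x := by
  induction t generalizing f g with
  | zero => exact hfg
  | succ t ih =>
    exact ih fun x hx => h.step_le_step hx (hfg x hx) (hfg (x + 1)) (hfg _ (by omega))

lemma iterate_le (h : Rates N w u d) (t : ℕ) {f : ℕ → ℝ} {a : ℝ} (hf : ∀ x ≤ N, f x ≤ a) :
    ∀ x ≤ N, (step u d)^[t] f x ≤ a := by
  have := h.iterate_le_iterate t (g := fun _ => a) hf
  rwa [iterate_const] at this

lemma le_iterate (h : Rates N w u d) (t : ℕ) {f : ℕ → ℝ} {a : ℝ} (hf : ∀ x ≤ N, a ≤ f x) :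
    ∀ x ≤ N, a ≤ (step u d)^[t] f x := by
  have := h.iterate_le_iterate t (f := fun _ => a) hf
  rwa [iterate_const] at this

/-- Summation by parts for the generator. -/
lemma sum_mul_step_sub (h : Rates N w u d) (f g : ℕ → ℝ) :
    ∑ x ∈ Finset.range (N + 1), w x * g x * (step u d f x - f x) =
      - ∑ j ∈ Finset.range N, w j * u j * ((f (j + 1) - f j) * (g (j + 1) - g j)) := by
  -- Partial sums carry a boundary flux through the edge (n, n + 1), which vanishes at n = N because
  -- u N = 0.
  have key : ∀ n ≤ N, ∑ x ∈ Finset.range (n + 1), w x * g x * (step u d f x - f x) =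
      w n * u n * g n * (f (n + 1) - f n) -
        ∑ j ∈ Finset.range n, w j * u j * ((f (j + 1) - f j) * (g (j + 1) - g j)) := by
    intro n
    induction n with
    | zero => intro _; simp [step, h.d_zero]; ring
    | succ n ih =>
      intro hn
      rw [Finset.sum_range_succ, ih (by omega), Finset.sum_range_succ _ n]
      have hb := h.balance n hn
      simp only [step, Nat.add_sub_cancel]
      linear_combination (-(g (n+1) * (f n - f (n+1)))) * hb
  rw [key N le_rfl, h.u_top]
  ring

lemma sum_step (h : Rates N w u d) (f : ℕ → ℝ) :
    ∑ x ∈ Finset.range (N + 1), w x * step u d f x = ∑ x ∈ Finset.range (N + 1), w x * f x := by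
  have := h.sum_mul_step_sub f (fun _ => 1)
  simp only [mul_one, sub_self, mul_zero, Finset.sum_const_zero, neg_zero, mul_sub,
    Finset.sum_sub_distrib] at this
  linarith

lemma sum_iterate (h : Rates N w u d) (t : ℕ) (f : ℕ → ℝ) :
    ∑ x ∈ Finset.range (N + 1), w x * (step u d)^[t] f x =
      ∑ x ∈ Finset.range (N + 1), w x * f x := by
  induction t generalizing f with
  | zero => rfl
  | succ t ih => rw [Function.iterate_succ, Function.comp, ih, h.sum_step]

/-! ### Passage times -/

/-- First-step analysis: one step lowers the mean remaining passage time by exactly 1. -/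
lemma step_passMean (h : Rates N w u d) {x : ℕ} (hx : x < N) :
    u x * edgeMean w u x - d x * edgeMean w u (x - 1) = 1 := by
  have hw := h.w_pos x hx.le
  have h1 := h.edge_mul_edgeMean hx
  refine mul_left_cancel₀ hw.ne' ?_
  rcases x with _ | x
  · simp [cum, h.d_zero] at h1 ⊢; linarith
  · have h2 := h.edge_mul_edgeMean (j := x) (by omega)
    rw [h.balance x (by omega)] at h2
    have h3 : cum w (x + 1) = cum w x + w (x + 1) := Finset.sum_range_succ ..
    simp only [Nat.add_sub_cancel]
    linear_combination h1 - h2 + h3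

/-- The recurrence for the true variance has an extra -1 on the right; dropping it keeps a clean
closed form and yields an upper bound. -/
lemma step_passVar (h : Rates N w u d) {x : ℕ} (hx : x < N) :
    u x * edgeVar w u x - d x * edgeVar w u (x - 1) =
      u x * edgeMean w u x ^ 2 + d x * edgeMean w u (x - 1) ^ 2 := by
  have hw := h.w_pos x hx.le
  have h1 := h.edge_mul_edgeVar hx
  refine mul_left_cancel₀ hw.ne' ?_
  rcases x with _ | x
  · simp only [h.d_zero, Finset.range_zero, Finset.sum_empty] at h1 ⊢; linarith
  · have h2 := h.edge_mul_edgeVar (j := x) (by omega)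
    have hb := h.balance x (by omega)
    rw [Finset.sum_range_succ] at h1
    simp only [Nat.add_sub_cancel]
    linear_combination h1 - h2 + hb * (edgeVar w u x + edgeMean w u x ^ 2)

/-- The quadratic function whose value along the chain bounds the second moment of the
passage time to `l`, shifted by `b`. -/
noncomputable def passQuad (w u : ℕ → ℝ) (l : ℕ) (b : ℝ) (x : ℕ) : ℝ :=
  passVar w u l - passVar w u x + (passMean w u l - passMean w u x + b) ^ 2

/-- Since b increases by 1 per unit of time, this is the supermartingale property of the quadratic
at states below N. By the two recurrences above, the drift is exactly -1. -/
lemma step_passQuad_le (h : Rates N w u d) (l : ℕ) (b : ℝ) {x : ℕ} (hx : x < N) :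
    step u d (passQuad w u l (b + 1)) x ≤ passQuad w u l b x := by
  have h1 := h.step_passMean hx
  have h2 := h.step_passVar hx
  have m1 : passMean w u (x + 1) = passMean w u x + edgeMean w u x := Finset.sum_range_succ ..
  have v1 : passVar w u (x + 1) = passVar w u x + edgeVar w u x := Finset.sum_range_succ ..
  have h3 : d x * (passQuad w u l (b + 1) (x - 1) - passQuad w u l (b + 1) x) =
      d x * (edgeVar w u (x - 1) + edgeMean w u (x - 1) ^ 2 +
        2 * edgeMean w u (x - 1) * (passMean w u l - passMean w u x + b + 1)) := by
    rcases x with _ | x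
    · simp [h.d_zero]
    · have m2 : passMean w u (x + 1) = passMean w u x + edgeMean w u x := Finset.sum_range_succ ..
      have v2 : passVar w u (x + 1) = passVar w u x + edgeVar w u x := Finset.sum_range_succ ..
      simp only [Nat.add_sub_cancel, passQuad, m2, v2]
      ring
  rw [step, h3]
  simp only [passQuad, m1, v1]
  nlinarith [h1, h2]

lemma sq_le_passQuad (h : Rates N w u d) {l x : ℕ} (hl : l ≤ N) (hx : x ≤ l) (b : ℝ) (hb : 0 ≤ b) :
    b ^ 2 ≤ passQuad w u l b x := by
  have h1 := h.passVar_mono hx hl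
  have h2 := h.passMean_mono hx hl
  rw [passQuad]
  nlinarith

lemma passQuad_nonneg (h : Rates N w u d) {l x : ℕ} (hl : l ≤ N) (hx : x ≤ l) (b : ℝ) :
    0 ≤ passQuad w u l b x :=
  add_nonneg (sub_nonneg.2 (h.passVar_mono hx hl)) (sq_nonneg _)

lemma passQuad_self (l : ℕ) (b : ℝ) : passQuad w u l b l = b ^ 2 := by simp [passQuad]

/-- A Chebyshev bound for the probability that the chain has not yet passed `l`, in terms of
any function whose evolution at `l` stays below a constant `r`. -/
lemma iterate_sub_mul_le (h : Rates N w u d) {l : ℕ} (hl : l ≤ N) {f : ℕ → ℝ} {r : ℝ}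
    (hf : ∀ x ≤ N, f x ≤ 1) (hr : 0 ≤ r) (hfl : ∀ t, (step u d)^[t] f l ≤ r) (t : ℕ) :
    ∀ b : ℝ, 0 ≤ t + b → ∀ x ≤ l,
      ((step u d)^[t] f x - r) * (t + b) ^ 2 ≤ passQuad w u l b x := by
  induction t with
  | zero =>
    intro b hb x hx
    simp only [Nat.cast_zero, zero_add, Function.iterate_zero, id] at *
    refine le_trans ?_ (h.sq_le_passQuad hl hx b hb)
    have := hf x (hx.trans hl)
    nlinarith [sq_nonneg b]
  | succ t ih =>
    intro b hb x hx
    rcases hx.lt_or_eq with hx' | rfl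
    · refine le_trans ?_ (h.step_passQuad_le l b (by omega))
      have hb' : (0 : ℝ) ≤ t + (b + 1) := by push_cast at hb; linarith
      have := h.step_le_step (x := x) (by omega)
        (f := fun y => ((step u d)^[t] f y - r) * (t + (b + 1)) ^ 2)
        (ih (b + 1) hb' x hx) (fun _ => ih (b + 1) hb' (x + 1) hx')
        (ih (b + 1) hb' (x - 1) (by omega))
      refine le_trans (le_of_eq ?_) this
      rw [Function.iterate_succ', Function.comp]
      simp only [step]
      push_cast
      ring
    -- At l the chain counts as passed: the left side is nonpositive by `hfl`, so later times need
    -- no control.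
    · refine le_trans ?_ (h.passQuad_nonneg hl le_rfl b)
      exact mul_nonpos_of_nonpos_of_nonneg (sub_nonpos.2 (hfl _)) (sq_nonneg _)

/-- A Chebyshev bound for the probability that the chain has passed `l` early. -/
lemma iterate_mul_le (h : Rates N w u d) {l : ℕ} (hl : l ≤ N) {f : ℕ → ℝ}
    (hf : ∀ x ≤ N, f x ≤ 1) (hf0 : ∀ x < l, f x = 0) (t : ℕ) :
    ∀ b : ℝ, t + b ≤ 0 → ∀ x ≤ l,
      (step u d)^[t] f x * (t + b) ^ 2 ≤ passQuad w u l b x := by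
  -- At l the quadratic is b², and 0 ≤ t ≤ -b gives (t + b)² ≤ b²: an early passage is penalised at
  -- least as much as (t + b)².
  have hself : ∀ t : ℕ, ∀ b : ℝ, t + b ≤ 0 →
      (step u d)^[t] f l * (t + b) ^ 2 ≤ passQuad w u l b l := by
    intro t b hb
    rw [passQuad_self]
    have h1 := h.iterate_le t hf l hl
    have h2 : (0 : ℝ) ≤ t := t.cast_nonneg
    nlinarith [sq_nonneg (t + b)]
  induction t with
  | zero =>
    intro b hb x hx
    rcases hx.lt_or_eq with hx' | rfl
    · simpa [hf0 x hx'] using h.passQuad_nonneg hl hx b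
    · exact hself 0 b hb
  | succ t ih =>
    intro b hb x hx
    rcases hx.lt_or_eq with hx' | rfl
    · refine le_trans ?_ (h.step_passQuad_le l b (by omega))
      have hb' : (t : ℝ) + (b + 1) ≤ 0 := by push_cast at hb; linarith
      have := h.step_le_step (x := x) (by omega)
        (f := fun y => (step u d)^[t] f y * (t + (b + 1)) ^ 2)
        (ih (b + 1) hb' x hx) (fun _ => ih (b + 1) hb' (x + 1) hx')
        (ih (b + 1) hb' (x - 1) (by omega))
      refine le_trans (le_of_eq ?_) this
      rw [Function.iterate_succ', Function.comp]
      simp only [step]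
      push_cast
      ring
    · exact hself _ b hb

/-! ### Consequences of the Poincaré inequality -/

lemma sum_range_mul_passMean_sub (n : ℕ) :
    ∑ x ∈ Finset.range n, w x * (passMean w u n - passMean w u x) =
      ∑ i ∈ Finset.range n, cum w i * edgeMean w u i := by
  induction n with
  | zero => simp
  | succ n ih =>
    have m1 : passMean w u (n + 1) = passMean w u n + edgeMean w u n := Finset.sum_range_succ ..
    have e : ∀ x, w x * (passMean w u (n + 1) - passMean w u x) =
        w x * (passMean w u n - passMean w u x) + w x * edgeMean w u n := fun x => by rw [m1]; ring
    simp only [e, Finset.sum_add_distrib]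
    rw [Finset.sum_range_succ _ n, ih, sub_self, mul_zero, add_zero, ← Finset.sum_mul,
      Finset.sum_range_succ (fun i => cum w i * edgeMean w u i), cum]

/-- Test Poincaré on g, the mean passage time to j + 1, extended by 0. Its energy S equals its mean,
since the edge weight times `edgeMean` is `cum`. Cauchy–Schwarz on {0, …, j} gives S² ≤ cum w j · Q
with Q the second moment of g, so the variance is at least δQ and γδQ ≤ S. Together, γδS ≤ cum w j,
and `edgeVar` times the edge weight is at most 2S. -/
lemma edgeVar_le (h : Rates N w u d) {γ δ : ℝ} (hP : Poincare N w u γ) (hγ : 0 < γ) (hδ : 0 < δ)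
    {j : ℕ} (hj : j < N) (hW : cum w j ≤ 1 - δ) :
    edgeVar w u j ≤ 2 / (δ * γ) * edgeMean w u j := by
  set g : ℕ → ℝ := fun x => passMean w u (j + 1) - passMean w u (min x (j + 1)) with hg
  set S := ∑ i ∈ Finset.range (j + 1), w i * u i * edgeMean w u i ^ 2 with hS
  have gz : ∀ x, j + 1 ≤ x → g x = 0 := fun x hx => by simp [hg, min_eq_right hx]
  have gl : ∀ x ∈ Finset.range (j + 1), g x = passMean w u (j + 1) - passMean w u x := by
    intro x hx
    simp at hx
    simp [hg, min_eq_left (show x ≤ j + 1 by omega)]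
  have hsub : Finset.range (j + 1) ⊆ Finset.range (N + 1) := by simp; omega
  have e1 : ∑ i ∈ Finset.range N, w i * u i * (g (i + 1) - g i) ^ 2 = S := by
    rw [← Finset.sum_subset (s₁ := Finset.range (j + 1)) (by simpa using hj)]
    · refine Finset.sum_congr rfl fun i hi => ?_
      rw [gl i hi]
      simp at hi
      have m1 : passMean w u (i + 1) = passMean w u i + edgeMean w u i := Finset.sum_range_succ ..
      simp only [hg, min_eq_left (show i + 1 ≤ j + 1 by omega), m1]
      ring
    · intro i _ hi
      simp at hi
      simp [gz i (by omega), gz (i + 1) (by omega)]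
  have e2 : ∑ x ∈ Finset.range (N + 1), w x * g x = ∑ x ∈ Finset.range (j + 1), w x * g x :=
    (Finset.sum_subset hsub fun x _ hx => by simp at hx; simp [gz x (by omega)]).symm
  have e3 : ∑ x ∈ Finset.range (N + 1), w x * g x ^ 2 =
      ∑ x ∈ Finset.range (j + 1), w x * g x ^ 2 :=
    (Finset.sum_subset hsub fun x _ hx => by simp at hx; simp [gz x (by omega)]).symm
  have e4 : ∑ x ∈ Finset.range (j + 1), w x * g x = S := by
    rw [Finset.sum_congr rfl fun x hx => by rw [gl x hx], sum_range_mul_passMean_sub]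
    refine Finset.sum_congr rfl fun i hi => ?_
    rw [← h.edge_mul_edgeMean (j := i) (by simp at hi; omega)]
    ring
  have cs : S ^ 2 ≤ cum w j * ∑ x ∈ Finset.range (j + 1), w x * g x ^ 2 := by
    rw [← e4]
    refine Finset.sum_sq_le_sum_mul_sum_of_sq_le_mul _ (fun i hi => ?_) (fun i hi => ?_)
      (fun i _ => le_of_eq (by ring))
    · exact (h.w_pos i (by simp at hi; omega)).le
    · exact mul_nonneg (h.w_pos i (by simp at hi; omega)).le (sq_nonneg _)
  have hp := hP g
  rw [e1, e2, e3, e4] at hp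
  set Q := ∑ x ∈ Finset.range (j + 1), w x * g x ^ 2
  have hS0 : 0 < S := Finset.sum_pos (fun i hi => by
    simp at hi
    exact mul_pos (h.edge_pos (by omega)) (pow_pos (h.edgeMean_pos (by omega)) 2)) ⟨0, by simp⟩
  have hc := h.cum_pos hj.le
  have hQ : 0 ≤ Q := by
    by_contra hq
    nlinarith [sq_nonneg S]
  have h1 : γ * δ * Q ≤ S := by
    refine le_trans ?_ hp
    rw [mul_assoc]
    refine mul_le_mul_of_nonneg_left ?_ hγ.le
    nlinarith
  have h2 : γ * δ * S ≤ cum w j := by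
    have h3 : γ * δ * S ^ 2 ≤ cum w j * S :=
      calc γ * δ * S ^ 2 ≤ γ * δ * (cum w j * Q) :=
            mul_le_mul_of_nonneg_left cs (mul_pos hγ hδ).le
        _ = cum w j * (γ * δ * Q) := by ring
        _ ≤ cum w j * S := mul_le_mul_of_nonneg_left h1 hc.le
    nlinarith
  have hcj := h.edge_pos hj
  have h4 : w j * u j * edgeVar w u j ≤ 2 * S := by
    rw [h.edge_mul_edgeVar hj, hS, Finset.sum_range_succ]
    nlinarith [mul_nonneg hcj.le (sq_nonneg (edgeMean w u j))]
  refine le_of_mul_le_mul_left ?_ hcj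
  calc _ ≤ 2 * S := h4
    _ ≤ 2 / (δ * γ) * cum w j := by
      rw [div_mul_eq_mul_div, le_div_iff₀ (mul_pos hδ hγ)]
      nlinarith
    _ = _ := by rw [← h.edge_mul_edgeMean hj]; ring

lemma passVar_le (h : Rates N w u d) {γ δ : ℝ} (hP : Poincare N w u γ) (hγ : 0 < γ) (hδ : 0 < δ)
    {l : ℕ} (hl : l ≤ N) (hW : ∀ j < l, cum w j ≤ 1 - δ) :
    passVar w u l ≤ 2 / (δ * γ) * passMean w u l := by
  rw [passVar, passMean, Finset.mul_sum]
  refine Finset.sum_le_sum fun j hj => ?_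
  rw [Finset.mem_range] at hj
  exact h.edgeVar_le hP hγ hδ (by omega) (hW j hj)

/-- Test Poincaré on the mean passage time frozen outside [a, b]. An edge inside contributes cum ·
edgeMean ≤ edgeMean to the energy, so the energy is at most the difference ρ. Mass at least ε sits
at each of the two extreme values, so the variance is at least ερ²/2. -/
lemma passMean_sub_le (h : Rates N w u d) {γ ε : ℝ} (hP : Poincare N w u γ) (hγ : 0 < γ)
    (hε : 0 < ε) {a b : ℕ} (haN : a ≤ N) (hb : b ≤ N) (ha : ε ≤ cum w a)
    (hW : ∀ j < b, cum w j ≤ 1 - ε) :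
    passMean w u b - passMean w u a ≤ 2 / (ε * γ) := by
  rcases le_or_gt b a with hab | hab
  · have := h.passMean_mono hab haN
    have : 0 ≤ 2 / (ε * γ) := by positivity
    linarith
  set f : ℕ → ℝ := fun x => passMean w u (max a (min x b)) with hf
  have fa : ∀ x, x ≤ a → f x = passMean w u a := fun x hx => by
    simp only [hf]; congr 1; omega
  have fb : ∀ x, b ≤ x → f x = passMean w u b := fun x hx => by
    simp only [hf]; congr 1; omega
  set ρ := passMean w u b - passMean w u a with hρ
  have hρ0 : 0 ≤ ρ := sub_nonneg.2 (h.passMean_mono hab.le hb)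
  have e1 : ∑ i ∈ Finset.range N, w i * u i * (f (i + 1) - f i) ^ 2 ≤ ρ := by
    have : ρ = ∑ i ∈ Finset.range N, (f (i + 1) - f i) := by
      rw [Finset.sum_range_sub, fa 0 (by omega), fb N hb]
    rw [this]
    refine Finset.sum_le_sum fun i hi => ?_
    rw [Finset.mem_range] at hi
    rcases lt_or_ge i a with hia | hia
    · rw [fa i hia.le, fa (i + 1) hia]; simp
    rcases le_or_gt b i with hib | hib
    · rw [fb i hib, fb (i + 1) (by omega)]; simp
    have m1 : passMean w u (i + 1) = passMean w u i + edgeMean w u i := Finset.sum_range_succ ..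
    have : f (i + 1) - f i = edgeMean w u i := by
      simp only [hf, show max a (min (i + 1) b) = i + 1 by omega,
        show max a (min i b) = i by omega, m1]
      ring
    rw [this, sq, ← mul_assoc, h.edge_mul_edgeMean hi]
    nlinarith [h.edgeMean_pos hi, h.cum_le_one hi.le]
  set m := ∑ x ∈ Finset.range (N + 1), w x * f x with hm
  have e2 : ∑ x ∈ Finset.range (N + 1), w x * f x ^ 2 - m ^ 2 =
      ∑ x ∈ Finset.range (N + 1), w x * (f x - m) ^ 2 := by
    have : ∀ x, w x * (f x - m) ^ 2 = w x * f x ^ 2 - 2 * m * (w x * f x) + m ^ 2 * w x :=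
      fun x => by ring
    simp only [this, Finset.sum_add_distrib, Finset.sum_sub_distrib, ← Finset.mul_sum, h.sum_w,
      ← hm]
    ring
  have e3 : ε * (passMean w u a - m) ^ 2 + ε * (passMean w u b - m) ^ 2 ≤
      ∑ x ∈ Finset.range (N + 1), w x * (f x - m) ^ 2 := by
    have hbN : ∑ x ∈ Finset.range (N + 1), w x * (f x - m) ^ 2 =
        ∑ x ∈ Finset.range b, w x * (f x - m) ^ 2 +
          ∑ x ∈ Finset.Ico b (N + 1), w x * (f x - m) ^ 2 :=
      (Finset.sum_range_add_sum_Ico _ (by omega)).symm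
    rw [hbN]
    refine add_le_add ?_ ?_
    · calc ε * (passMean w u a - m) ^ 2 ≤ cum w a * (passMean w u a - m) ^ 2 :=
            mul_le_mul_of_nonneg_right ha (sq_nonneg _)
        _ = ∑ x ∈ Finset.range (a + 1), w x * (f x - m) ^ 2 := by
            rw [cum, Finset.sum_mul]
            refine Finset.sum_congr rfl fun x hx => ?_
            rw [fa x (by simp at hx; omega)]
        _ ≤ _ := Finset.sum_le_sum_of_subset_of_nonneg (by simpa using hab) fun x hx _ =>
            mul_nonneg (h.w_pos x (by simp at hx; omega)).le (sq_nonneg _)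
    · have hs : ε ≤ ∑ x ∈ Finset.Ico b (N + 1), w x := by
        have h1 := Finset.sum_range_add_sum_Ico w (show b ≤ N + 1 by omega)
        have h2 := hW (b - 1) (by omega)
        rw [cum, show b - 1 + 1 = b by omega] at h2
        have := h.sum_w
        linarith
      calc ε * (passMean w u b - m) ^ 2 ≤
            (∑ x ∈ Finset.Ico b (N + 1), w x) * (passMean w u b - m) ^ 2 :=
            mul_le_mul_of_nonneg_right hs (sq_nonneg _)
        _ = _ := by
            rw [Finset.sum_mul]
            refine Finset.sum_congr rfl fun x hx => ?_
            rw [fb x (by simp at hx; omega)]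
  have hp := (hP f).trans e1
  rw [← hm, e2] at hp
  have h5 : γ * (ε * ρ ^ 2 / 2) ≤ ρ := by
    refine le_trans (mul_le_mul_of_nonneg_left (le_trans ?_ e3) hγ.le) hp
    have : 0 ≤ ε * (passMean w u a - m + (passMean w u b - m)) ^ 2 := by positivity
    rw [hρ]
    linarith
  rw [le_div_iff₀ (mul_pos hε hγ)]
  by_contra! hc
  have : 0 < ρ := by
    rcases hρ0.lt_or_eq with h0 | h0
    · exact h0
    · rw [← h0] at hc; norm_num at hc
  nlinarith

/-! ### Shape preservation -/

/-- Increments evolve by a three-term recursion with coefficients that are nonnegative for a lazy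
chain; monotonicity and, away from the peak, unimodality follow from it. -/
lemma step_succ_sub_step (f : ℕ → ℝ) (x : ℕ) :
    step u d f (x + 1) - step u d f x = d x * (f x - f (x - 1)) +
      (1 - d (x + 1) - u x) * (f (x + 1) - f x) + u (x + 1) * (f (x + 2) - f (x + 1)) := by
  simp only [step, Nat.add_sub_cancel]
  ring

lemma step_antitone (h : Rates N w u d) {f : ℕ → ℝ} (hf : ∀ x < N, f (x + 1) ≤ f x) :
    ∀ x < N, step u d f (x + 1) ≤ step u d f x := by
  intro x hx
  rw [← sub_nonpos, step_succ_sub_step]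
  have h1 : d x * (f x - f (x - 1)) ≤ 0 := by
    rcases x with _ | x
    · simp
    · exact mul_nonpos_of_nonneg_of_nonpos (h.d_nonneg hx.le) (sub_nonpos.2 (hf x (by omega)))
  have h2 : (1 - d (x + 1) - u x) * (f (x + 1) - f x) ≤ 0 := by
    refine mul_nonpos_of_nonneg_of_nonpos ?_ (sub_nonpos.2 (hf x hx))
    linarith [h.lazy x hx.le, h.lazy (x + 1) hx, h.u_nonneg hx, h.d_nonneg hx.le]
  have h3 : u (x + 1) * (f (x + 2) - f (x + 1)) ≤ 0 := by
    rcases (show x + 1 ≤ N from hx).lt_or_eq with hx' | hx'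
    · exact mul_nonpos_of_nonneg_of_nonpos (h.u_nonneg hx) (sub_nonpos.2 (hf _ hx'))
    · simp [hx', h.u_top]
  linarith

lemma iterate_antitone (h : Rates N w u d) (t : ℕ) {f : ℕ → ℝ} (hf : ∀ x < N, f (x + 1) ≤ f x) :
    ∀ x < N, (step u d)^[t] f (x + 1) ≤ (step u d)^[t] f x := by
  induction t generalizing f with
  | zero => exact hf
  | succ t ih => exact ih (h.step_antitone hf)

/-- `f` increases up to some point of `{0, …, N}` and decreases from there on. -/
def Unimodal (N : ℕ) (f : ℕ → ℝ) : Prop :=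
  ∃ i ≤ N, (∀ x < i, f x ≤ f (x + 1)) ∧ ∀ x < N, i ≤ x → f (x + 1) ≤ f x

/-- Away from the peak i the increments keep their sign, so only the two increments adjacent to i
can change. Each sign pattern of these puts the new peak at i - 1, i or i + 1, except a valley at i,
which laziness excludes. -/
lemma step_unimodal (h : Rates N w u d) {f : ℕ → ℝ} (hf : Unimodal N f) :
    Unimodal N (step u d f) := by
  obtain ⟨i, hi, hinc, hdec⟩ := hf
  have inc : ∀ x, x + 1 < i → step u d f x ≤ step u d f (x + 1) := by
    intro x hx
    rw [← sub_nonneg, step_succ_sub_step]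
    have h1 : 0 ≤ d x * (f x - f (x - 1)) := by
      rcases x with _ | x
      · simp
      · exact mul_nonneg (h.d_nonneg (by omega)) (sub_nonneg.2 (hinc x (by omega)))
    have h2 : 0 ≤ (1 - d (x + 1) - u x) * (f (x + 1) - f x) := by
      refine mul_nonneg ?_ (sub_nonneg.2 (hinc x (by omega)))
      linarith [h.lazy x (by omega), h.lazy (x + 1) (by omega), h.u_nonneg (x := x + 1) (by omega),
        h.d_nonneg (x := x) (by omega)]
    have h3 : 0 ≤ u (x + 1) * (f (x + 2) - f (x + 1)) :=
      mul_nonneg (h.u_nonneg (by omega)) (sub_nonneg.2 (hinc _ hx))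
    linarith
  have dec : ∀ x < N, i + 1 ≤ x → step u d f (x + 1) ≤ step u d f x := by
    intro x hx hix
    rw [← sub_nonpos, step_succ_sub_step]
    have h1 : d x * (f x - f (x - 1)) ≤ 0 := by
      rcases x with _ | x
      · simp
      · exact mul_nonpos_of_nonneg_of_nonpos (h.d_nonneg hx.le)
          (sub_nonpos.2 (hdec x (by omega) (by omega)))
    have h2 : (1 - d (x + 1) - u x) * (f (x + 1) - f x) ≤ 0 := by
      refine mul_nonpos_of_nonneg_of_nonpos ?_ (sub_nonpos.2 (hdec x hx (by omega)))
      linarith [h.lazy x hx.le, h.lazy (x + 1) hx, h.u_nonneg hx, h.d_nonneg hx.le]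
    have h3 : u (x + 1) * (f (x + 2) - f (x + 1)) ≤ 0 := by
      rcases (show x + 1 ≤ N from hx).lt_or_eq with hx' | hx'
      · exact mul_nonpos_of_nonneg_of_nonpos (h.u_nonneg hx)
          (sub_nonpos.2 (hdec _ hx' (by omega)))
      · simp [hx', h.u_top]
    linarith
  by_cases hA : ∀ x, x + 1 = i → step u d f x ≤ step u d f (x + 1)
  · by_cases hB : i < N → step u d f (i + 1) ≤ step u d f i
    · refine ⟨i, hi, fun x hx => ?_, fun x hx hix => ?_⟩
      · rcases (show x + 1 ≤ i from hx).lt_or_eq with hx | hx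
        exacts [inc x hx, hA x hx]
      · rcases hix.lt_or_eq with hx' | rfl
        exacts [dec x hx hx', hB hx]
    · push Not at hB
      refine ⟨i + 1, hB.1, fun x hx => ?_, fun x hx hix => dec x hx hix⟩
      rcases lt_trichotomy (x + 1) i with hx' | hx' | hx'
      · exact inc x hx'
      · exact hA x hx'
      · obtain rfl : x = i := by omega
        exact hB.2.le
  · push Not at hA
    obtain ⟨j, rfl, hj⟩ := hA
    by_cases hB : j + 1 < N → step u d f (j + 1 + 1) ≤ step u d f (j + 1)
    · refine ⟨j, by omega, fun x hx => inc x (by omega), fun x hx hix => ?_⟩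
      rcases hix.lt_or_eq with hx' | rfl
      · rcases (show j + 1 ≤ x from hx').lt_or_eq with hx' | rfl
        exacts [dec x hx hx', hB hx]
      · exact hj.le
    · push Not at hB
      obtain ⟨hN, hB⟩ := hB
      -- Valley case. Let a ≥ 0 ≥ b be the old increments on the two sides of the peak. As holding
      -- probabilities are at least 1/2, a fall on the left forces a + b < 0 and a rise on the right
      -- forces a + b > 0.
      exfalso
      rw [← sub_neg, step_succ_sub_step] at hj
      rw [← sub_pos, step_succ_sub_step] at hB
      simp only [Nat.add_sub_cancel, add_assoc, Nat.reduceAdd] at hj hB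
      have h0 : 0 ≤ d j * (f j - f (j - 1)) := by
        rcases j with _ | j
        · simp
        · exact mul_nonneg (h.d_nonneg (by omega)) (sub_nonneg.2 (hinc j (by omega)))
      have h3 : u (j + 2) * (f (j + 3) - f (j + 2)) ≤ 0 := by
        rcases (show j + 2 ≤ N from hN).lt_or_eq with hx' | hx'
        · exact mul_nonpos_of_nonneg_of_nonpos (h.u_nonneg hN)
            (sub_nonpos.2 (hdec _ hx' (by omega)))
        · simp [hx', h.u_top]
      have ha : 0 ≤ f (j + 1) - f j := sub_nonneg.2 (hinc j (by omega))
      have hb : f (j + 2) - f (j + 1) ≤ 0 := sub_nonpos.2 (hdec (j + 1) hN le_rfl)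
      have l0 := h.lazy j (by omega)
      have l1 := h.lazy (j + 1) hi
      have l2 := h.lazy (j + 2) hN
      have d0 := h.d_nonneg (x := j) (by omega)
      have u1 := h.u_nonneg hi
      have d1 := h.d_nonneg hi
      have u2 := h.u_nonneg (x := j + 2) hN
      have k1 : 0 ≤ (1 - d (j + 1) - u j - u (j + 1)) * (f (j + 1) - f j) :=
        mul_nonneg (by linarith) ha
      have k2 : (1 - d (j + 2) - u (j + 1) - d (j + 1)) * (f (j + 2) - f (j + 1)) ≤ 0 :=
        mul_nonpos_of_nonneg_of_nonpos (by linarith) hb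
      have k3 : u (j + 1) * ((f (j + 1) - f j) + (f (j + 2) - f (j + 1))) < 0 := by nlinarith
      have k4 : 0 < d (j + 1) * ((f (j + 1) - f j) + (f (j + 2) - f (j + 1))) := by nlinarith
      nlinarith [pos_of_mul_pos_right k4 d1]

lemma iterate_unimodal (h : Rates N w u d) (t : ℕ) {f : ℕ → ℝ} (hf : Unimodal N f) :
    Unimodal N ((step u d)^[t] f) := by
  induction t generalizing f with
  | zero => exact hf
  | succ t ih => exact ih (h.step_unimodal hf)

lemma unimodal_single {x : ℕ} (hx : x ≤ N) : Unimodal N (Pi.single x 1) := by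
  have h0 : ∀ y, (0 : ℝ) ≤ Pi.single (M := fun _ => ℝ) x 1 y := fun y => by
    rw [Pi.single_apply]; split_ifs <;> norm_num
  refine ⟨x, hx, fun y hy => ?_, fun y _ hy => ?_⟩
  · rw [Pi.single_eq_of_ne hy.ne]
    exact h0 _
  · rw [Pi.single_eq_of_ne (by omega : y + 1 ≠ x)]
    exact h0 _

/-- Superlevel sets of unimodal functions are intervals. -/
lemma Unimodal.lt_of_mem {f : ℕ → ℝ} (hf : Unimodal N f) {c : ℝ} {a b y : ℕ} (hay : a ≤ y)
    (hyb : y ≤ b) (hb : b ≤ N) (hfa : c < f a) (hfb : c < f b) : c < f y := by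
  obtain ⟨i, -, hinc, hdec⟩ := hf
  rcases le_or_gt y i with hyi | hyi
  · refine hfa.trans_le ?_
    induction y, hay using Nat.le_induction with
    | base => rfl
    | succ n hn ih => exact (ih (by omega) (by omega)).trans (hinc n hyi)
  · refine hfb.trans_le ?_
    induction b, hyb using Nat.le_induction with
    | base => rfl
    | succ n hn ih =>
      have hstep := hdec n hb (by omega)
      exact hstep.trans (ih (by omega) (hfb.trans_le hstep))

/-! ### Half-line indicators, reversibility, and reduction to the endpoints. -/

/-- Indicator of `{0, …, k}`. -/
noncomputable def below (k x : ℕ) : ℝ := if x ≤ k then 1 else 0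

/-- Indicator of `{k, k + 1, …}`. -/
noncomputable def above (k x : ℕ) : ℝ := if k ≤ x then 1 else 0

lemma sum_mul_below {k : ℕ} (hk : k ≤ N) :
    ∑ x ∈ Finset.range (N + 1), w x * below k x = cum w k := by
  simp only [below, mul_ite, mul_one, mul_zero]
  rw [← Finset.sum_filter, cum]
  congr 1
  ext x
  simp
  omega

lemma sum_iterate_single (t : ℕ) (s : Finset ℕ) :
    ∑ y ∈ s, (step u d)^[t] (Pi.single y 1) =
      (step u d)^[t] (fun z => if z ∈ s then 1 else 0) := by
  induction s using Finset.induction_on with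
  | empty =>
    simp only [Finset.sum_empty, Finset.notMem_empty, if_false]
    exact (iterate_const t 0).symm
  | insert a s ha ih =>
    rw [Finset.sum_insert ha, ih, ← iterate_add]
    congr 1
    ext z
    by_cases hz : z = a
    · subst hz; simp [ha]
    · simp [hz]

lemma sum_mul_iterate_comm (h : Rates N w u d) (t : ℕ) (f g : ℕ → ℝ) :
    ∑ x ∈ Finset.range (N + 1), w x * g x * (step u d)^[t] f x =
      ∑ x ∈ Finset.range (N + 1), w x * f x * (step u d)^[t] g x := by
  have one : ∀ f g : ℕ → ℝ, ∑ x ∈ Finset.range (N + 1), w x * g x * step u d f x =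
      ∑ x ∈ Finset.range (N + 1), w x * f x * step u d g x := by
    intro f g
    have split : ∀ f g : ℕ → ℝ, ∑ x ∈ Finset.range (N + 1), w x * g x * step u d f x =
        ∑ x ∈ Finset.range (N + 1), w x * g x * f x -
          ∑ j ∈ Finset.range N, w j * u j * ((f (j + 1) - f j) * (g (j + 1) - g j)) := by
      intro f g
      rw [sub_eq_add_neg, ← h.sum_mul_step_sub, ← Finset.sum_add_distrib]
      exact Finset.sum_congr rfl fun x _ => by ring
    rw [split, split]
    congr 1
    · exact Finset.sum_congr rfl fun x _ => by ring
    · exact Finset.sum_congr rfl fun x _ => by ring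
  induction t generalizing f g with
  | zero => exact Finset.sum_congr rfl fun x _ => by simp; ring
  | succ t ih =>
    rw [Function.iterate_succ_apply, ih, Function.iterate_succ_apply', one]
    exact Finset.sum_congr rfl fun x _ => by ring

/-- Detailed balance for the `t`-step kernel. -/
lemma iterate_single_balance (h : Rates N w u d) (t : ℕ) {x y : ℕ} (hx : x ≤ N) (hy : y ≤ N) :
    w x * (step u d)^[t] (Pi.single y 1) x = w y * (step u d)^[t] (Pi.single x 1) y := by
  have key : ∀ z ≤ N, ∀ g : ℕ → ℝ,
      ∑ a ∈ Finset.range (N + 1), w a * Pi.single (M := fun _ => ℝ) z 1 a * g a = w z * g z := by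
    intro z hz g
    rw [Finset.sum_eq_single z]
    · simp
    · intro b _ hb; simp [hb]
    · intro hn; simp at hn; omega
  rw [← key x hx, ← key y hy, h.sum_mul_iterate_comm]

/-- Lets every estimate for the chain started at 0 be used for the chain started at N. -/
lemma iterate_reflect (h : Rates N w u d) (t : ℕ) (f : ℕ → ℝ) : ∀ x ≤ N,
    (step (fun x => d (N - x)) (fun x => u (N - x)))^[t] (fun x => f (N - x)) x =
      (step u d)^[t] f (N - x) := by
  induction t with
  | zero => intro x _; rfl
  | succ t ih =>
    intro x hx
    rw [Function.iterate_succ', Function.comp, Function.iterate_succ', Function.comp,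
      h.reflect.step_congr ih hx]
    simp only [step]
    have e1 : N - (x + 1) = N - x - 1 := by omega
    rw [e1]
    rcases x with _ | x
    · simp [h.u_top]
    · rw [show N - (x + 1 - 1) = N - (x + 1) + 1 by omega]
      ring

lemma below_antitone (k x : ℕ) : below k (x + 1) ≤ below k x := by
  simp only [below]
  split_ifs <;> first | omega | norm_num

lemma below_le_one (k x : ℕ) : below k x ≤ 1 := by
  simp only [below]
  split_ifs <;> norm_num

lemma above_le_one (k x : ℕ) : above k x ≤ 1 := by
  simp only [above]
  split_ifs <;> norm_num

lemma iterate_below_le_of_le (h : Rates N w u d) (t k : ℕ) {x y : ℕ} (hxy : x ≤ y) (hy : y ≤ N) :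
    (step u d)^[t] (below k) y ≤ (step u d)^[t] (below k) x := by
  induction y, hxy using Nat.le_induction with
  | base => rfl
  | succ n hn ih =>
    exact (h.iterate_antitone t (fun x _ => below_antitone k x) n hy).trans (ih (by omega))

lemma iterate_below_le (h : Rates N w u d) (t k : ℕ) {x : ℕ} (hx : x ≤ N) :
    (step u d)^[t] (below k) x ≤ (step u d)^[t] (below k) 0 :=
  h.iterate_below_le_of_le t k (Nat.zero_le x) hx

/-- The one-sided discrepancy from stationarity of the chain started at `x`, bounded by the
discrepancies of the chains started at the two ends on initial and final segments. -/
lemma sum_posPart_le (h : Rates N w u d) {t : ℕ} {A B : ℝ}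
    (hA : ∀ k ≤ N, (step u d)^[t] (below k) 0 - cum w k ≤ A)
    (hB : ∀ k ≤ N, (step (fun x => d (N - x)) (fun x => u (N - x)))^[t] (below k) 0 -
      cum (fun x => w (N - x)) k ≤ B) {x : ℕ} (hx : x ≤ N) :
    ∑ y ∈ Finset.range (N + 1), max 0 ((step u d)^[t] (Pi.single y 1) x - w y) ≤ A + B := by
  have hA0 : 0 ≤ A := by
    refine le_trans ?_ (hA N le_rfl)
    have := h.le_iterate t (f := below N) (a := 1) (fun y hy => by simp [below, hy]) 0 (by omega)
    rw [h.cum_top]; linarith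
  have hB0 : 0 ≤ B := by
    refine le_trans ?_ (hB N le_rfl)
    have := h.reflect.le_iterate t (f := below N) (a := 1)
      (fun y hy => by simp [below, hy]) 0 (by omega)
    rw [h.reflect.cum_top]; linarith
  set S := (Finset.range (N + 1)).filter fun y => w y < (step u d)^[t] (Pi.single y 1) x with hS
  have e1 : ∑ y ∈ Finset.range (N + 1), max 0 ((step u d)^[t] (Pi.single y 1) x - w y) =
      ∑ y ∈ S, ((step u d)^[t] (Pi.single y 1) x - w y) := by
    rw [hS, Finset.sum_filter]
    refine Finset.sum_congr rfl fun y _ => ?_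
    split_ifs with hy
    · exact max_eq_right (sub_nonneg.2 hy.le)
    · exact max_eq_left (sub_nonpos.2 (not_lt.1 hy))
  rw [e1]
  rcases S.eq_empty_or_nonempty with hE | hE
  · rw [hE, Finset.sum_empty]; positivity
  set a := S.min' hE
  set b := S.max' hE
  have haS : a ∈ S := S.min'_mem hE
  have hbS : b ∈ S := S.max'_mem hE
  -- By detailed balance, P^t(x, y) > π(y) is equivalent to P^t(y, x) > π(x), a superlevel set of
  -- the evolved point mass at x, hence of a unimodal function.
  have memS : ∀ y, y ∈ S ↔ y ≤ N ∧ w x < (step u d)^[t] (Pi.single x 1) y := by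
    intro y
    rw [hS, Finset.mem_filter, Finset.mem_range, Nat.lt_succ_iff]
    refine and_congr_right fun hy => ?_
    have hb := h.iterate_single_balance t hx hy
    have hwx := h.w_pos x hx
    have hwy := h.w_pos y hy
    rw [← mul_lt_mul_iff_right₀ hwx, hb, mul_comm (w x), mul_lt_mul_iff_right₀ hwy]
  have hab : a ≤ b := S.min'_le _ hbS
  have hbN : b ≤ N := ((memS b).1 hbS).1
  have hSI : S = Finset.Icc a b := by
    ext y
    rw [Finset.mem_Icc]
    refine ⟨fun hy => ⟨S.min'_le _ hy, S.le_max' _ hy⟩, fun hy => (memS y).2 ⟨by omega, ?_⟩⟩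
    exact (h.iterate_unimodal t (unimodal_single hx)).lt_of_mem hy.1 hy.2 hbN
      ((memS a).1 haS).2 ((memS b).1 hbS).2
  -- Valid because a ≤ b: an interval indicator is a sum of two half-line indicators minus 1.
  have e2 : (fun z => if z ∈ Finset.Icc a b then (1 : ℝ) else 0) + (fun _ => 1) =
      below b + above a := by
    ext z
    simp only [Pi.add_apply, below, above, Finset.mem_Icc]
    split_ifs <;> first | omega | norm_num
  have e3 : ∑ y ∈ S, (step u d)^[t] (Pi.single y 1) x + 1 =
      (step u d)^[t] (below b) x + (step u d)^[t] (above a) x := by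
    have h1 := congrFun (congrArg (step u d)^[t] e2) x
    rw [iterate_add, iterate_add, iterate_const, ← sum_iterate_single, ← hSI] at h1
    simpa using h1
  have e4 : ∑ y ∈ S, w y + 1 = cum w b + cum (fun x => w (N - x)) (N - a) := by
    have h1 : ∑ z ∈ Finset.range (N + 1), w z * ((fun z => if z ∈ Finset.Icc a b then (1 : ℝ)
        else 0) + (fun _ => (1 : ℝ)) : ℕ → ℝ) z = ∑ z ∈ Finset.range (N + 1), w z * ((below b + above a) z) := by
      rw [e2]
    simp only [Pi.add_apply, mul_add, Finset.sum_add_distrib, mul_one, h.sum_w,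
      sum_mul_below hbN] at h1
    have h2 : ∑ z ∈ Finset.range (N + 1), w z * above a z =
        cum (fun x => w (N - x)) (N - a) := by
      rw [← sum_mul_below (N := N) (w := fun x => w (N - x)) (by omega),
        ← Finset.sum_range_reflect]
      refine Finset.sum_congr rfl fun z hz => ?_
      rw [Finset.mem_range] at hz
      simp only [Nat.add_sub_cancel, above, below]
      congr 2
      simp only [eq_iff_iff]
      omega
    rw [h2] at h1
    rw [← h1]
    congr 1
    simp only [mul_ite, mul_one, mul_zero]
    rw [← Finset.sum_filter]
    congr 1
    ext z
    rw [hSI]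
    simp
    omega
  have h1 : (step u d)^[t] (below b) x ≤ (step u d)^[t] (below b) 0 := by
    exact h.iterate_below_le t b hx
  have h2 : (step u d)^[t] (above a) x ≤
      (step (fun x => d (N - x)) (fun x => u (N - x)))^[t] (below (N - a)) 0 := by
    refine le_trans (le_of_eq ?_) (h.reflect.iterate_below_le t (N - a) (x := N - x) (by omega))
    have h3 := h.iterate_reflect t (above a) (N - x) (by omega)
    rw [show N - (N - x) = x by omega] at h3
    rw [← h3]
    refine h.reflect.iterate_congr t (fun y hy => ?_) _ (by omega)
    simp only [below, above]
    congr 1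
    simp only [eq_iff_iff]
    omega
  rw [Finset.sum_sub_distrib]
  have := hA b hbN
  have := hB (N - a) (by omega)
  linarith

/-! ### Concentration of the passage from 0. -/

/-- After the mean passage time to `l` plus a few standard deviations, the chain started at `0`
has almost passed to stationarity. -/
lemma iterate_below_sub_cum_le (h : Rates N w u d) {γ ε : ℝ} (hP : Poincare N w u γ) (hγ : 0 < γ)
    (hε : 0 < ε) (hε1 : ε < 1) {l : ℕ} (hl : l ≤ N) (hlc : 1 - ε ≤ cum w l)
    (hW : ∀ j < l, cum w j ≤ 1 - ε) {t : ℕ}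
    (ht : passMean w u l + √(2 * passMean w u l / (ε ^ 2 * γ)) < t) {k : ℕ} (hk : k ≤ N) :
    (step u d)^[t] (below k) 0 - cum w k ≤ 2 * ε := by
  have hf1 := h.iterate_le t (fun x _ => below_le_one k x) 0 (Nat.zero_le N)
  -- If {0, …, k} already has mass at least 1 - ε, the discrepancy is trivially at most ε.
  rcases le_or_gt (1 - ε) (cum w k) with hc | hc
  · linarith
  have hck := h.cum_pos hk
  have hcl := h.cum_pos hl
  -- The evolved indicator is antitone, so its value at l is at most its average over {0, …, l}, and
  -- its total integral stays equal to cum w k.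
  have hfl : ∀ t, (step u d)^[t] (below k) l ≤ cum w k / cum w l := by
    intro t
    rw [le_div_iff₀ hcl, mul_comm, ← sum_mul_below hk, ← h.sum_iterate t, cum, Finset.sum_mul]
    have h0 := h.le_iterate t (f := below k) (a := 0) (fun x _ => by
      simp only [below]; split_ifs <;> norm_num)
    refine le_trans (Finset.sum_le_sum fun x hx => mul_le_mul_of_nonneg_left
      (h.iterate_below_le_of_le t k (show x ≤ l by simp at hx; omega) hl)
      (h.w_pos x (by simp at hx; omega)).le) ?_
    refine Finset.sum_le_sum_of_subset_of_nonneg (by simp; omega) fun x hx _ => ?_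
    have hx' : x ≤ N := by simp at hx; omega
    exact mul_nonneg (h.w_pos x hx').le (h0 x hx')
  set A := passMean w u l with hA
  have hm0 : passMean w u 0 = 0 := rfl
  have hv0 : passVar w u 0 = 0 := rfl
  have hA0 : 0 ≤ A := by simpa [hm0] using h.passMean_mono (Nat.zero_le l) hl
  have hs := Real.sqrt_nonneg (2 * A / (ε ^ 2 * γ))
  have cheb := h.iterate_sub_mul_le hl (fun x _ => below_le_one k x)
    (div_nonneg hck.le hcl.le) hfl t (-A) (by linarith) 0 (Nat.zero_le l)
  have hV := h.passVar_le hP hγ hε hl hW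
  have hpos : 0 < (t : ℝ) - A := by linarith
  -- The square root in `ht` is chosen so that the Chebyshev ratio passVar / (t - A)² is at most ε.
  have hsq : 2 * A / (ε ^ 2 * γ) ≤ (t - A) ^ 2 := by
    rw [← Real.sqrt_le_left hpos.le]
    linarith
  have hV' : passVar w u l ≤ ε * (t - A) ^ 2 :=
    calc _ ≤ 2 / (ε * γ) * A := hV
      _ = ε * (2 * A / (ε ^ 2 * γ)) := by field_simp
      _ ≤ _ := mul_le_mul_of_nonneg_left hsq hε.le
  have h1 : (step u d)^[t] (below k) 0 - cum w k / cum w l ≤ ε := by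
    have e : passQuad w u l (-A) 0 = passVar w u l := by simp [passQuad, hm0, hv0, ← hA]
    rw [e, ← sub_eq_add_neg] at cheb
    exact le_of_mul_le_mul_right (cheb.trans hV') (pow_pos hpos 2)
  -- Uses cum w l ≥ 1 - ε together with cum w k < 1 - ε.
  have h2 : cum w k / cum w l ≤ cum w k + ε := by
    rw [div_le_iff₀ hcl]
    nlinarith
  linarith

/-- Well before the mean passage time to `l`, the chain started at `0` is still below `l`. -/
lemma iterate_above_le (h : Rates N w u d) {γ ε : ℝ} (hP : Poincare N w u γ) (hγ : 0 < γ)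
    (hε : 0 < ε) {l : ℕ} (hl : l ≤ N) (hW : ∀ j < l, cum w j ≤ 1 - ε) {t : ℕ}
    (ht : t < passMean w u l - √(2 * passMean w u l / (ε ^ 2 * γ))) :
    (step u d)^[t] (above l) 0 ≤ ε := by
  set A := passMean w u l with hA
  have hm0 : passMean w u 0 = 0 := rfl
  have hv0 : passVar w u 0 = 0 := rfl
  have hs := Real.sqrt_nonneg (2 * A / (ε ^ 2 * γ))
  have cheb := h.iterate_mul_le hl (fun x _ => above_le_one l x)
    (fun x hx => by simp [above, hx]) t (-A) (by linarith) 0 (Nat.zero_le l)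
  have hV := h.passVar_le hP hγ hε hl hW
  have hpos : 0 < A - t := by linarith
  have hsq : 2 * A / (ε ^ 2 * γ) ≤ (A - t) ^ 2 := by
    rw [← Real.sqrt_le_left hpos.le]
    linarith
  have hV' : passVar w u l ≤ ε * (A - t) ^ 2 :=
    calc _ ≤ 2 / (ε * γ) * A := hV
      _ = ε * (2 * A / (ε ^ 2 * γ)) := by field_simp
      _ ≤ _ := mul_le_mul_of_nonneg_left hsq hε.le
  have e : passQuad w u l (-A) 0 = passVar w u l := by simp [passQuad, hm0, hv0, ← hA]
  rw [e, show (t + -A) ^ 2 = (A - t) ^ 2 by ring] at cheb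
  exact le_of_mul_le_mul_right (cheb.trans hV') (pow_pos hpos 2)

lemma exists_quantile (h : Rates N w u d) {α : ℝ} (hα : α ≤ 1) :
    ∃ l ≤ N, α ≤ cum w l ∧ ∀ j < l, cum w j < α := by
  have hex : ∃ l, α ≤ cum w l := ⟨N, h.cum_top ▸ hα⟩
  classical
  refine ⟨Nat.find hex, Nat.find_min' hex (h.cum_top ▸ hα), Nat.find_spec hex, fun j hj => ?_⟩
  exact not_le.1 (Nat.find_min hex hj)

end Rates

/-! ### The rates of a transition matrix -/

section Matrix

variable {N : ℕ}

/-- Extension by zero of a vector indexed by `Fin (N + 1)`. -/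
noncomputable def extend (p : Fin (N + 1) → ℝ) (x : ℕ) : ℝ :=
  if h : x < N + 1 then p ⟨x, h⟩ else 0

/-- Extension by zero of a matrix indexed by `Fin (N + 1)`. -/
noncomputable def entry (P : Matrix (Fin (N + 1)) (Fin (N + 1)) ℝ) (x y : ℕ) : ℝ :=
  if h : x < N + 1 then extend (P ⟨x, h⟩) y else 0

/-- Up probabilities. -/
noncomputable def up (P : Matrix (Fin (N + 1)) (Fin (N + 1)) ℝ) (x : ℕ) : ℝ := entry P x (x + 1)

/-- Down probabilities. -/
noncomputable def down (P : Matrix (Fin (N + 1)) (Fin (N + 1)) ℝ) (x : ℕ) : ℝ :=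
  if x = 0 then 0 else entry P x (x - 1)

@[simp] lemma extend_val (p : Fin (N + 1) → ℝ) (x : Fin (N + 1)) : extend p x = p x :=
  dif_pos x.is_lt

@[simp] lemma entry_val (P : Matrix (Fin (N + 1)) (Fin (N + 1)) ℝ) (x y : Fin (N + 1)) :
    entry P x y = P x y :=
  (dif_pos x.is_lt).trans (extend_val _ y)

lemma sum_eq_of_nearest {G : ℕ → ℝ} {x : ℕ} (hx : x ≤ N) (hG : ∀ y, N < y → G y = 0)
    (hn : ∀ y ≤ N, x + 1 < y ∨ y + 1 < x → G y = 0) :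
    ∑ y ∈ Finset.range (N + 1), G y = (if x = 0 then 0 else G (x - 1)) + G x + G (x + 1) := by
  have e : ∑ y ∈ Finset.range (N + 1), G y = ∑ y ∈ Finset.range (x + 2), G y := by
    rcases hx.lt_or_eq with hx | rfl
    · refine (Finset.sum_subset (by simp; omega) fun y h1 h2 => ?_).symm
      simp at h1 h2
      exact hn y (by omega) (by omega)
    · rw [Finset.sum_range_succ _ (x + 1), hG (x + 1) (by omega), add_zero]
  rw [e, Finset.sum_range_succ, Finset.sum_range_succ]
  congr 2
  rcases x with _ | x
  · simp
  · rw [Finset.sum_range_succ, Finset.sum_eq_zero fun y hy => ?_]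
    · simp
    · simp at hy
      exact hn y (by omega) (by omega)

lemma sum_fin_eq (G : Fin (N + 1) → ℝ) : ∑ y, G y = ∑ y ∈ Finset.range (N + 1), extend G y := by
  rw [← Fin.sum_univ_eq_sum_range]
  simp

variable {P : Matrix (Fin (N + 1)) (Fin (N + 1)) ℝ} {p : Fin (N + 1) → ℝ}

lemma IsBirthDeath.row_sum (hBD : IsBirthDeath P) (f : ℕ → ℝ) (x : Fin (N + 1)) :
    ∑ y, P x y * f y = down P x * f (x - 1) + P x x * f x + up P x * f (x + 1) := by
  have e : ∑ y, P x y * f y = ∑ y ∈ Finset.range (N + 1), entry P x y * f y := by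
    rw [← Fin.sum_univ_eq_sum_range (fun y => entry P x y * f y)]
    simp
  rw [e, sum_eq_of_nearest (x := x) (by omega)]
  · simp only [down, up, entry_val]
    split_ifs <;> ring
  · intro y hy
    simp [entry, extend, show ¬ y ≤ N by omega]
  · intro y hy hxy
    rw [show y = ((⟨y, by omega⟩ : Fin (N + 1)) : ℕ) from rfl, entry_val, hBD.nearest _ _ hxy,
      zero_mul]

lemma IsBirthDeath.down_add_up (hBD : IsBirthDeath P) (x : Fin (N + 1)) :
    down P x + P x x + up P x = 1 := by
  have := hBD.row_sum (fun _ => 1) x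
  simp only [mul_one] at this
  rw [← this]
  exact Matrix.sum_row_of_mem_rowStochastic hBD.stochastic x

lemma IsBirthDeath.mulVec_eq_step (hBD : IsBirthDeath P) (f : ℕ → ℝ) (x : Fin (N + 1)) :
    (P.mulVec fun y => f y) x = step (up P) (down P) f x := by
  rw [Matrix.mulVec, dotProduct, hBD.row_sum, step]
  linear_combination f x * hBD.down_add_up x

lemma IsBirthDeath.pow_mulVec (hBD : IsBirthDeath P) (f : ℕ → ℝ) (t : ℕ) (x : Fin (N + 1)) :
    ((P ^ t).mulVec fun y => f y) x = (step (up P) (down P))^[t] f x := by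
  induction t generalizing x with
  | zero => simp
  | succ t ih =>
    rw [pow_succ', ← Matrix.mulVec_mulVec, Function.iterate_succ_apply', ← hBD.mulVec_eq_step]
    congr 1
    ext y
    exact ih y

lemma IsBirthDeath.pow_apply (hBD : IsBirthDeath P) (t : ℕ) (x y : Fin (N + 1)) :
    (P ^ t) x y = (step (up P) (down P))^[t] (Pi.single (y : ℕ) 1) x := by
  rw [← hBD.pow_mulVec]
  have : (fun z : Fin (N + 1) => (Pi.single (y : ℕ) 1 : ℕ → ℝ) z) = Pi.single y 1 := by
    ext z
    simp [Pi.single_apply, Fin.ext_iff]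
  rw [this, Matrix.mulVec_single_one]
  rfl

lemma up_pos (hBD : IsBirthDeath P) (hirr : P.IsIrreducible) {x : ℕ} (hx : x < N) :
    0 < up P x := by
  have e : up P x = P ⟨x, by omega⟩ ⟨x + 1, by omega⟩ := entry_val P ⟨x, by omega⟩ ⟨x + 1, by omega⟩
  rw [e]
  refine lt_of_le_of_ne (hirr.nonneg _ _) fun h0 => ?_
  -- If the edge from x to x + 1 had probability 0, no path could ever leave {0, …, x}, against
  -- irreducibility.
  have key : ∀ k : ℕ, ∀ a b : Fin (N + 1), (a : ℕ) ≤ x → x < (b : ℕ) → (P ^ k) a b = 0 := by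
    intro k
    induction k with
    | zero =>
      intro a b ha hb
      exact Matrix.one_apply_ne (by rintro rfl; omega)
    | succ k ih =>
      intro a b ha hb
      rw [pow_succ, Matrix.mul_apply]
      refine Finset.sum_eq_zero fun z _ => ?_
      rcases le_or_gt (z : ℕ) x with hz | hz
      · by_cases hzb : (z : ℕ) = x ∧ (b : ℕ) = x + 1
        · rw [(congrArg₂ P (Fin.ext hzb.1) (Fin.ext hzb.2)).trans h0.symm, mul_zero]
        · rw [hBD.nearest z b (by omega), mul_zero]
      · rw [ih a z ha hz, zero_mul]
  obtain ⟨k, -, hk⟩ := (Matrix.isIrreducible_iff_exists_pow_pos hirr.nonneg).1 hirr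
    ⟨0, by omega⟩ ⟨N, by omega⟩
  rw [key k _ _ (Nat.zero_le x) hx] at hk
  exact hk.false

lemma stationary_pow (hp : IsStationary P p) (k : ℕ) : Matrix.vecMul p (P ^ k) = p := by
  induction k with
  | zero => simp
  | succ k ih => rw [pow_succ, ← Matrix.vecMul_vecMul, ih, hp.2]

lemma stationary_pos (hirr : P.IsIrreducible) (hp : IsStationary P p) (x : Fin (N + 1)) :
    0 < p x := by
  have h0 : ∀ y, 0 ≤ p y := hp.1.1
  obtain ⟨y, hy⟩ : ∃ y, 0 < p y := by
    by_contra! hn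
    have := hp.1.2
    rw [Finset.sum_eq_zero fun y _ => le_antisymm (hn y) (h0 y)] at this
    exact zero_ne_one this
  obtain ⟨k, -, hk⟩ := (Matrix.isIrreducible_iff_exists_pow_pos hirr.nonneg).1 hirr y x
  rw [← stationary_pow hp k]
  refine (mul_pos hy hk).trans_le ?_
  exact Finset.single_le_sum (f := fun z => p z * (P ^ k) z x)
    (fun z _ => mul_nonneg (h0 z) (Matrix.pow_apply_nonneg hirr.nonneg k z x)) (Finset.mem_univ y)

/-- On a path, stationarity at a vertex says that the net fluxes through its two edges agree; there
is no edge to the left of 0, so induction makes every net flux zero. -/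
lemma balance_of_stationary (hBD : IsBirthDeath P) (hp : IsStationary P p) :
    ∀ x < N, extend p x * up P x = extend p (x + 1) * down P (x + 1) := by
  have key : ∀ x ≤ N, extend p x = (if x = 0 then 0 else extend p (x - 1) * up P (x - 1)) +
      extend p x * (1 - down P x - up P x) + extend p (x + 1) * down P (x + 1) := by
    intro x hx
    have h1 := congrFun hp.2 ⟨x, by omega⟩
    have h2 := hBD.down_add_up ⟨x, by omega⟩
    have e : (Matrix.vecMul p P) ⟨x, by omega⟩ =
        ∑ y ∈ Finset.range (N + 1), extend p y * entry P y x := by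
      rw [← Fin.sum_univ_eq_sum_range (fun y => extend p y * entry P y x), Matrix.vecMul,
        dotProduct]
      refine Finset.sum_congr rfl fun y _ => ?_
      rw [extend_val]
      exact congrArg _ (entry_val P y ⟨x, by omega⟩).symm
    rw [e, sum_eq_of_nearest hx] at h1
    · have e1 : extend p x = p ⟨x, by omega⟩ := extend_val p ⟨x, by omega⟩
      have e2 : entry P x x = P ⟨x, by omega⟩ ⟨x, by omega⟩ := entry_val P ⟨x, _⟩ ⟨x, _⟩
      have e3 : 1 - down P x - up P x = entry P x x := by
        rw [e2]
        simp only at h2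
        linarith
      rw [e3]
      refine (e1.trans h1.symm).trans ?_
      congr 2
      rcases x with _ | x
      · simp
      · simp [up]
    · intro y hy
      simp [extend, show ¬ y ≤ N by omega]
    · intro y hy hxy
      have := entry_val P ⟨y, by omega⟩ ⟨x, by omega⟩
      simp only at this
      rw [this, hBD.nearest _ _ (by simp; omega), mul_zero]
  intro x
  induction x with
  | zero =>
    intro hx
    have := key 0 (Nat.zero_le N)
    simp only [if_true, down, zero_add] at this ⊢
    linarith
  | succ x ih =>
    intro hx
    have h1 := key (x + 1) (by omega)
    have h2 := ih (by omega)
    simp only [Nat.add_eq_zero_iff, one_ne_zero, and_false, if_false, Nat.add_sub_cancel] at h1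
    linarith

lemma rates_of_matrix (hBD : IsBirthDeath P) (hlazy : IsLazy P) (hirr : P.IsIrreducible)
    (hp : IsStationary P p) : Rates N (extend p) (up P) (down P) where
  w_pos x hx := by
    rw [show extend p x = p ⟨x, by omega⟩ from extend_val p ⟨x, by omega⟩]
    exact stationary_pos hirr hp _
  sum_w := by rw [← sum_fin_eq, hp.1.2]
  u_pos x hx := up_pos hBD hirr hx
  u_top := by simp [up, entry, extend]
  d_zero := by simp [down]
  lazy x hx := by
    have h1 := hBD.down_add_up ⟨x, by omega⟩
    have h2 := hlazy ⟨x, by omega⟩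
    simp only at h1
    linarith
  balance := balance_of_stationary hBD hp

/-! ### Total variation -/

variable {Ω : Type*} [Fintype Ω]

lemma tv_comm (μ ν : Ω → ℝ) : tv μ ν = tv ν μ := by
  simp only [tv, abs_sub_comm]

lemma tv_nonneg (μ ν : Ω → ℝ) : 0 ≤ tv μ ν :=
  mul_nonneg (by norm_num) (Finset.sum_nonneg fun _ _ => abs_nonneg _)

lemma tv_eq_sum_posPart {μ ν : Ω → ℝ} (h : ∑ x, μ x = ∑ x, ν x) :
    tv μ ν = ∑ x, max 0 (μ x - ν x) := by
  have e : ∀ a : ℝ, |a| = 2 * max 0 a - a := by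
    intro a
    rcases le_total 0 a with ha | ha
    · rw [abs_of_nonneg ha, max_eq_right ha]; ring
    · rw [abs_of_nonpos ha, max_eq_left ha]; ring
  simp only [tv, e, Finset.sum_sub_distrib, ← Finset.mul_sum, h]
  ring

lemma sum_mul_sub_le_tv {μ ν : Ω → ℝ} (h : ∑ x, μ x = ∑ x, ν x) {f : Ω → ℝ} (h0 : ∀ x, 0 ≤ f x)
    (h1 : ∀ x, f x ≤ 1) : ∑ x, μ x * f x - ∑ x, ν x * f x ≤ tv μ ν := by
  rw [tv_eq_sum_posPart h, ← Finset.sum_sub_distrib]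
  refine Finset.sum_le_sum fun x _ => ?_
  rw [← sub_mul]
  rcases le_total 0 (μ x - ν x) with ha | ha
  · rw [max_eq_right ha]
    exact mul_le_of_le_one_right ha (h1 x)
  · rw [max_eq_left ha]
    exact mul_nonpos_of_nonpos_of_nonneg ha (h0 x)

lemma tv_le_worstDist [DecidableEq Ω] (P : Matrix Ω Ω ℝ) (p : Ω → ℝ) (t : ℕ) (x : Ω) :
    tv ((P ^ t) x) p ≤ worstDist P p t :=
  le_ciSup (f := fun x => tv ((P ^ t) x) p) (Set.finite_range _).bddAbove x

lemma sum_pow_row (hBD : IsBirthDeath P) (hp : IsStationary P p) (t : ℕ) (x : Fin (N + 1)) :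
    ∑ y, (P ^ t) x y = ∑ y, p y := by
  rw [hp.1.2]
  exact Matrix.sum_row_of_mem_rowStochastic (pow_mem hBD.stochastic t) x

lemma sum_sub_iterate_le_worstDist (hBD : IsBirthDeath P) (hp : IsStationary P p) (t : ℕ)
    {f : ℕ → ℝ} (h0 : ∀ x, 0 ≤ f x) (h1 : ∀ x, f x ≤ 1) {x : ℕ} (hx : x ≤ N) :
    ∑ y ∈ Finset.range (N + 1), extend p y * f y - (step (up P) (down P))^[t] f x ≤
      worstDist P p t := by
  have h2 := (sum_mul_sub_le_tv (sum_pow_row hBD hp t ⟨x, by omega⟩).symm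
    (f := fun y => f y) (fun y => h0 y) (fun y => h1 y))
  rw [tv_comm] at h2
  refine le_trans (le_of_eq ?_) (h2.trans (tv_le_worstDist P p t _))
  have h3 := hBD.pow_mulVec f t ⟨x, by omega⟩
  rw [Matrix.mulVec, dotProduct] at h3
  rw [h3, ← Fin.sum_univ_eq_sum_range (fun y => extend p y * f y)]
  simp

lemma worstDist_le (hBD : IsBirthDeath P) (hp : IsStationary P p)
    (h : Rates N (extend p) (up P) (down P)) {t : ℕ} {A B : ℝ}
    (hA : ∀ k ≤ N, (step (up P) (down P))^[t] (Rates.below k) 0 - cum (extend p) k ≤ A)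
    (hB : ∀ k ≤ N, (step (fun x => down P (N - x)) (fun x => up P (N - x)))^[t] (Rates.below k) 0 -
      cum (fun x => extend p (N - x)) k ≤ B) :
    worstDist P p t ≤ A + B := by
  refine ciSup_le fun x => ?_
  rw [tv_eq_sum_posPart (sum_pow_row hBD hp t x)]
  refine le_trans (le_of_eq ?_) (h.sum_posPart_le hA hB (x := x) (by omega))
  rw [← Fin.sum_univ_eq_sum_range (fun y => max 0
    ((step (up P) (down P))^[t] (Pi.single y 1) x - extend p y))]
  refine Finset.sum_congr rfl fun y _ => ?_
  rw [hBD.pow_apply, extend_val]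

end Matrix

/-! ### The spectral gap -/

section Eigenvalues

variable {Ω : Type*} [Fintype Ω] [DecidableEq Ω] {P : Matrix Ω Ω ℝ}

/-- Eigenvalues of a lazy stochastic matrix lie in `[0, 1]`. -/
lemma eigenvalue_mem_Icc (hst : P ∈ Matrix.rowStochastic ℝ Ω) (hlazy : IsLazy P) {μ : ℝ}
    (hμ : Module.End.HasEigenvalue (Matrix.toLin' P) μ) : μ ∈ Set.Icc (0 : ℝ) 1 := by
  obtain ⟨f, hf⟩ := hμ.exists_hasEigenvector
  have hPf : P.mulVec f = μ • f := by simpa using hf.apply_eq_smul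
  obtain ⟨z, hz⟩ := Function.ne_iff.1 hf.2
  have : Nonempty Ω := ⟨z⟩
  -- Gershgorin at a coordinate of maximal modulus: |μ - P x x| ≤ 1 - P x x, and P x x ≥ 1/2.
  obtain ⟨x, hx⟩ := Finite.exists_max fun y => |f y|
  have hfx : 0 < |f x| := (abs_pos.2 hz).trans_le (hx z)
  have h1 : ∑ y, P x y * f y = μ * f x := congrFun hPf x
  rw [← Finset.add_sum_erase _ _ (Finset.mem_univ x)] at h1
  have h2 : |∑ y ∈ Finset.univ.erase x, P x y * f y| ≤ (1 - P x x) * |f x| := by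
    refine (Finset.abs_sum_le_sum_abs _ _).trans ?_
    have h3 := Matrix.sum_row_of_mem_rowStochastic hst x
    rw [← Finset.add_sum_erase _ _ (Finset.mem_univ x)] at h3
    rw [show 1 - P x x = ∑ y ∈ Finset.univ.erase x, P x y by linarith, Finset.sum_mul]
    refine Finset.sum_le_sum fun y _ => ?_
    have h0 : 0 ≤ P x y := hst.1 x y
    rw [abs_mul, abs_of_nonneg h0]
    exact mul_le_mul_of_nonneg_left (hx y) h0
  rw [show ∑ y ∈ Finset.univ.erase x, P x y * f y = (μ - P x x) * f x by linarith, abs_mul] at h2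
  have h4 := abs_le.1 (le_of_mul_le_mul_right h2 hfx)
  have := hlazy x
  exact ⟨by linarith [h4.1], by linarith [h4.2]⟩

lemma lam_nonneg (P : Matrix Ω Ω ℝ) : 0 ≤ lam P := by
  refine Real.sSup_nonneg ?_
  rintro r ⟨μ, -, -, rfl⟩
  exact abs_nonneg μ

lemma finite_nontrivial_eigenvalues (P : Matrix Ω Ω ℝ) :
    {r | ∃ μ : ℝ, Module.End.HasEigenvalue (Matrix.toLin' P) μ ∧ μ ≠ 1 ∧ r = |μ|}.Finite := by
  refine ((Module.End.finite_hasEigenvalue (Matrix.toLin' P)).image fun μ => |μ|).subset ?_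
  rintro r ⟨μ, h, -, rfl⟩
  exact ⟨μ, h, rfl⟩

lemma abs_le_lam {μ : ℝ} (hμ : Module.End.HasEigenvalue (Matrix.toLin' P) μ) (h1 : μ ≠ 1) :
    |μ| ≤ lam P :=
  le_csSup (finite_nontrivial_eigenvalues P).bddAbove ⟨μ, hμ, h1, rfl⟩

lemma lam_eq_zero_or_mem (P : Matrix Ω Ω ℝ) : lam P = 0 ∨
    ∃ μ : ℝ, Module.End.HasEigenvalue (Matrix.toLin' P) μ ∧ μ ≠ 1 ∧ lam P = |μ| := by
  rcases Set.eq_empty_or_nonempty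
    {r | ∃ μ : ℝ, Module.End.HasEigenvalue (Matrix.toLin' P) μ ∧ μ ≠ 1 ∧ r = |μ|} with h | h
  · left; rw [lam, h, Real.sSup_empty]
  · right; exact h.csSup_mem (finite_nontrivial_eigenvalues P)

/-- The set of nontrivial moduli is finite, so `lam` is either 0 (empty set) or attained at an
eigenvalue in [0, 1) . -/
lemma gap_pos (hst : P ∈ Matrix.rowStochastic ℝ Ω) (hlazy : IsLazy P) : 0 < gap P := by
  rw [gap, sub_pos]
  rcases lam_eq_zero_or_mem P with h | ⟨μ, hμ, h1, h⟩
  · rw [h]; exact one_pos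
  · have := eigenvalue_mem_Icc hst hlazy hμ
    rw [h, abs_of_nonneg this.1]
    exact lt_of_le_of_ne this.2 h1

lemma gap_le_one (P : Matrix Ω Ω ℝ) : gap P ≤ 1 := by
  rw [gap]; linarith [lam_nonneg P]

/-- The spectral lower bound for the distance to stationarity. -/
lemma lam_pow_le (P : Matrix Ω Ω ℝ) {p : Ω → ℝ} (hp : IsStationary P p) [Nonempty Ω] {t : ℕ}
    (ht : t ≠ 0) : lam P ^ t ≤ 2 * worstDist P p t := by
  rcases lam_eq_zero_or_mem P with h | ⟨μ, hμ, h1, h⟩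
  · rw [h, zero_pow ht]
    obtain ⟨x⟩ := ‹Nonempty Ω›
    have := (tv_nonneg _ _).trans (tv_le_worstDist P p t x)
    linarith
  obtain ⟨f, hf⟩ := hμ.exists_hasEigenvector
  have hPf : P.mulVec f = μ • f := by simpa using hf.apply_eq_smul
  have hpow : ∀ t : ℕ, (P ^ t).mulVec f = μ ^ t • f := by
    intro t
    induction t with
    | zero => simp
    | succ t ih =>
      rw [pow_succ, ← Matrix.mulVec_mulVec, hPf, Matrix.mulVec_smul, ih, smul_smul, pow_succ,
        mul_comm]
  -- Stationarity makes an eigenvector with μ ≠ 1 have mean zero, so p can be subtracted from the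
  -- row of P^t for free.
  have hpf : p ⬝ᵥ f = 0 := by
    have h2 : p ⬝ᵥ f = μ * (p ⬝ᵥ f) := by
      conv_lhs => rw [← hp.2, ← Matrix.dotProduct_mulVec, hPf, dotProduct_smul, smul_eq_mul]
    have h3 : (1 - μ) * (p ⬝ᵥ f) = 0 := by linarith
    exact (mul_eq_zero.1 h3).resolve_left (sub_ne_zero.2 h1.symm)
  obtain ⟨z, hz⟩ := Function.ne_iff.1 hf.2
  obtain ⟨x, hx⟩ := Finite.exists_max fun y => |f y|
  have hfx : 0 < |f x| := (abs_pos.2 hz).trans_le (hx z)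
  have e : μ ^ t * f x = ∑ y, ((P ^ t) x y - p y) * f y := by
    simp only [sub_mul, Finset.sum_sub_distrib]
    have h4 : ∑ y, (P ^ t) x y * f y = μ ^ t * f x := congrFun (hpow t) x
    have h5 : ∑ y, p y * f y = 0 := hpf
    rw [h4, h5, sub_zero]
  have h6 : |μ| ^ t * |f x| ≤ 2 * tv ((P ^ t) x) p * |f x| := by
    rw [← abs_pow, ← abs_mul, e, tv, ← mul_assoc, mul_one_div_cancel two_ne_zero, one_mul,
      Finset.sum_mul]
    refine (Finset.abs_sum_le_sum_abs _ _).trans (Finset.sum_le_sum fun y _ => ?_)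
    rw [abs_mul]
    exact mul_le_mul_of_nonneg_left (hx y) (abs_nonneg _)
  have h7 := le_of_mul_le_mul_right h6 hfx
  rw [h]
  linarith [tv_le_worstDist P p t x]

end Eigenvalues

/-! ### The Poincaré inequality from the spectral theorem. -/

section Poincare

variable {N : ℕ} {P : Matrix (Fin (N + 1)) (Fin (N + 1)) ℝ} {p : Fin (N + 1) → ℝ}

lemma reversible (hBD : IsBirthDeath P) (h : Rates N (extend p) (up P) (down P))
    (x y : Fin (N + 1)) : p x * P x y = p y * P y x := by
  have h1 := h.iterate_single_balance 1 (x := x) (y := y) (by omega) (by omega)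
  rwa [← hBD.pow_apply, ← hBD.pow_apply, extend_val, extend_val, pow_one] at h1

/-- The Dirichlet form as a sum over edges. -/
lemma sum_mul_sub_mulVec (hBD : IsBirthDeath P) (h : Rates N (extend p) (up P) (down P))
    (f : Fin (N + 1) → ℝ) : ∑ x, p x * f x * (f x - P.mulVec f x) =
      ∑ j ∈ Finset.range N, extend p j * up P j * (extend f (j + 1) - extend f j) ^ 2 := by
  have h1 := h.sum_mul_step_sub (extend f) (extend f)
  rw [← Fin.sum_univ_eq_sum_range
    (fun x => extend p x * extend f x * (step (up P) (down P) (extend f) x - extend f x))] at h1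
  simp only [← hBD.mulVec_eq_step, extend_val] at h1
  simp only [sq]
  rw [← neg_inj, ← h1, ← Finset.sum_neg_distrib]
  exact Finset.sum_congr rfl fun x _ => by ring

/-- A birth-and-death chain satisfies the Poincaré inequality with its spectral gap. -/
lemma poincare_gap (hBD : IsBirthDeath P) (hp : IsStationary P p)
    (h : Rates N (extend p) (up P) (down P)) : Poincare N (extend p) (up P) (gap P) := by
  have hpos : ∀ x, 0 < p x := fun x => by simpa using h.w_pos x (by omega)
  have hs : ∀ x, 0 < √(p x) := fun x => Real.sqrt_pos.2 (hpos x)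
  have hsq : ∀ x, √(p x) * √(p x) = p x := fun x => Real.mul_self_sqrt (hpos x).le
  -- Conjugating by √p turns the reversible kernel into a symmetric matrix; an eigenvector b of A
  -- corresponds to the eigenvector b / √p of P.
  set A : Matrix (Fin (N + 1)) (Fin (N + 1)) ℝ := Matrix.of fun x y => √(p x) * P x y / √(p y)
    with hA
  have hAsymm : ∀ x y, A x y = A y x := by
    intro x y
    simp only [hA, Matrix.of_apply]
    rw [div_eq_div_iff (hs y).ne' (hs x).ne']
    have := reversible hBD h x y
    rw [← hsq x, ← hsq y] at this
    linarith
  have hH : A.IsHermitian := by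
    ext x y
    simp [hAsymm y x]
  have hAv : ∀ v x, A.mulVec v x = √(p x) * P.mulVec (fun y => v y / √(p y)) x := by
    intro v x
    simp only [Matrix.mulVec, dotProduct, hA, Matrix.of_apply, Finset.mul_sum]
    exact Finset.sum_congr rfl fun y _ => by ring
  set b := hH.eigenvectorBasis
  set ev := hH.eigenvalues
  set g : Fin (N + 1) → Fin (N + 1) → ℝ := fun i y => b i y / √(p y) with hg
  have hbA : ∀ i, A.mulVec (b i) = ev i • (b i : Fin (N + 1) → ℝ) := hH.mulVec_eigenvectorBasis
  have hgP : ∀ i, P.mulVec (g i) = ev i • g i := by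
    intro i
    ext x
    have h1 := congrFun (hbA i) x
    rw [hAv] at h1
    simp only [Pi.smul_apply, smul_eq_mul] at h1 ⊢
    rw [hg]
    simp only
    rw [mul_div_assoc', ← h1]
    field_simp [(hs x).ne']
  have hg0 : ∀ i, g i ≠ 0 := by
    intro i h0
    apply b.toBasis.ne_zero i
    ext x
    have := congrFun h0 x
    simp only [hg, Pi.zero_apply, div_eq_zero_iff, (hs x).ne', or_false] at this
    simpa using this
  have hev : ∀ i, Module.End.HasEigenvalue (Matrix.toLin' P) (ev i) := by
    intro i
    refine Module.End.hasEigenvalue_of_hasEigenvector (x := g i) ⟨?_, hg0 i⟩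
    rw [Module.End.mem_eigenspace_iff, Matrix.toLin'_apply, hgP]
  -- An eigenvector for 1 has zero Dirichlet energy, and every edge weight is positive, so it is
  -- constant.
  have hconst : ∀ i, ev i = 1 → ∀ x, g i x = g i 0 := by
    intro i hi x
    have h1 := sum_mul_sub_mulVec hBD h (g i)
    rw [hgP, hi, one_smul] at h1
    simp only [sub_self, mul_zero, Finset.sum_const_zero] at h1
    have h2 := (Finset.sum_eq_zero_iff_of_nonneg fun j hj =>
      mul_nonneg (h.edge_pos (Finset.mem_range.1 hj)).le (sq_nonneg _)).1 h1.symm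
    have h3 : ∀ n ≤ N, extend (g i) n = extend (g i) 0 := by
      intro n
      induction n with
      | zero => intro _; rfl
      | succ n ih =>
        intro hn
        have h4 := h2 n (Finset.mem_range.2 hn)
        rw [mul_eq_zero, or_iff_right (h.edge_pos hn).ne', sq_eq_zero_iff, sub_eq_zero] at h4
        rw [h4, ih (by omega)]
    have h5 := h3 x (by omega)
    rw [extend_val] at h5
    rw [h5]
    exact extend_val (g i) 0
  intro f
  set F : Fin (N + 1) → ℝ := fun x => f x with hF
  set m := ∑ x, p x * F x with hm
  set v : EuclideanSpace ℝ (Fin (N + 1)) := WithLp.toLp 2 fun x => √(p x) * (F x - m) with hv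
  have inner_eq : ∀ a c : EuclideanSpace ℝ (Fin (N + 1)), inner ℝ a c = ∑ x, a x * c x := by
    intro a c
    simp [PiLp.inner_apply, mul_comm]
  set Av : EuclideanSpace ℝ (Fin (N + 1)) := WithLp.toLp 2 (A.mulVec v) with hAvdef
  have hsum0 : ∑ x, p x * (F x - m) = 0 := by
    simp only [mul_sub, Finset.sum_sub_distrib, ← Finset.sum_mul, hp.1.2, ← hm]
    ring
  -- The centred function is orthogonal to constants, so only eigenvalues other than 1, all at most
  -- `lam`, enter the quadratic form.
  have horth : ∀ i, ev i = 1 → inner ℝ v (b i) = (0 : ℝ) := by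
    intro i hi
    rw [inner_eq]
    have : ∀ x, v x * b i x = g i 0 * (p x * (F x - m)) := by
      intro x
      have hb : b i x = √(p x) * g i x := (mul_div_cancel₀ _ (hs x).ne').symm
      rw [← hconst i hi x, hb, hv]
      simp only
      linear_combination (g i x * (F x - m)) * hsq x
    rw [Finset.sum_congr rfl fun x _ => this x, ← Finset.mul_sum, hsum0, mul_zero]
  have hAb : ∀ i, inner ℝ (b i) Av = ev i * inner ℝ (b i) v := by
    intro i
    rw [inner_eq, inner_eq]
    change (b i : Fin (N + 1) → ℝ) ⬝ᵥ A.mulVec v = ev i * ((b i : Fin (N + 1) → ℝ) ⬝ᵥ v)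
    have hT : A.transpose = A := by ext x y; exact hAsymm y x
    rw [Matrix.dotProduct_mulVec, ← Matrix.mulVec_transpose, hT, hbA, smul_dotProduct, smul_eq_mul]
  have hle : inner ℝ v Av ≤ lam P * inner ℝ v v := by
    rw [← b.sum_inner_mul_inner v Av, ← b.sum_inner_mul_inner v v, Finset.mul_sum]
    refine Finset.sum_le_sum fun i _ => ?_
    rw [hAb]
    by_cases hi : ev i = 1
    · rw [horth i hi]; simp
    · have h1 := (le_abs_self _).trans (abs_le_lam (hev i) hi)
      rw [real_inner_comm v (b i)]
      nlinarith [mul_self_nonneg (inner ℝ v (b i))]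
  have hvv : inner ℝ v v = ∑ x, p x * (F x - m) ^ 2 := by
    rw [inner_eq]
    refine Finset.sum_congr rfl fun x _ => ?_
    rw [← hsq x, hv]
    simp only
    ring
  have hvAv : inner ℝ v Av = ∑ x, p x * (F x - m) * P.mulVec (fun x => F x - m) x := by
    rw [inner_eq]
    refine Finset.sum_congr rfl fun x _ => ?_
    rw [hAvdef, hv]
    simp only
    rw [hAv]
    have : (fun y => √(p y) * (F y - m) / √(p y)) = fun y => F y - m := by
      ext y
      field_simp [(hs y).ne']
    rw [this]
    linear_combination ((F x - m) * P.mulVec (fun y => F y - m) x) * hsq x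
  have hD := sum_mul_sub_mulVec hBD h (fun x => F x - m)
  have hvar : ∑ x, p x * (F x - m) ^ 2 = ∑ x ∈ Finset.range (N + 1), extend p x * f x ^ 2 -
      (∑ x ∈ Finset.range (N + 1), extend p x * f x) ^ 2 := by
    rw [← Fin.sum_univ_eq_sum_range (fun x => extend p x * f x ^ 2),
      ← Fin.sum_univ_eq_sum_range (fun x => extend p x * f x)]
    simp only [extend_val]
    have h1 : ∀ x, p x * (F x - m) ^ 2 = p x * F x ^ 2 - 2 * m * (p x * F x) + m ^ 2 * p x :=
      fun x => by ring
    simp only [h1, Finset.sum_add_distrib, Finset.sum_sub_distrib, ← Finset.mul_sum, hp.1.2, ← hm]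
    change _ = ∑ x, p x * F x ^ 2 - m ^ 2
    ring
  rw [← hvar]
  have hDF : ∑ j ∈ Finset.range N, extend p j * up P j *
      (extend (fun x => F x - m) (j + 1) - extend (fun x => F x - m) j) ^ 2 =
      ∑ j ∈ Finset.range N, extend p j * up P j * (f (j + 1) - f j) ^ 2 := by
    refine Finset.sum_congr rfl fun j hj => ?_
    rw [Finset.mem_range] at hj
    have e1 : extend (fun x => F x - m) j = f j - m :=
      extend_val (fun x => F x - m) ⟨j, by omega⟩
    have e2 : extend (fun x => F x - m) (j + 1) = f (j + 1) - m :=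
      extend_val (fun x => F x - m) ⟨j + 1, by omega⟩
    rw [e1, e2]
    ring
  rw [← hDF, ← hD]
  rw [hvv, hvAv] at hle
  simp only [mul_sub (p _ * (F _ - m)), Finset.sum_sub_distrib]
  have e3 : ∑ x, p x * (F x - m) ^ 2 = ∑ x, p x * (F x - m) * (F x - m) :=
    Finset.sum_congr rfl fun x _ => by ring
  rw [gap, sub_mul, one_mul]
  have e4 : ∑ x, p x * (F x - m) * (F x - m) =
      ∑ x, p x * (F x - m) * F x - ∑ x, p x * (F x - m) * m := by
    rw [← Finset.sum_sub_distrib]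
    exact Finset.sum_congr rfl fun x _ => by ring
  linarith

end Poincare

/-! ### The width of the mixing-time profile -/

section Window

variable {N : ℕ} {w u d : ℕ → ℝ}

lemma Poincare.reflect {γ : ℝ} (h : Rates N w u d) (hP : Poincare N w u γ) :
    Poincare N (fun x => w (N - x)) (fun x => d (N - x)) γ := by
  intro f
  have h1 := hP fun x => f (N - x)
  have e : ∀ G : ℕ → ℝ, ∑ x ∈ Finset.range (N + 1), G (N - x) = ∑ x ∈ Finset.range (N + 1), G x :=
    fun G => by rw [← Finset.sum_range_reflect G (N + 1)]; simp
  have e1 : ∀ G H : ℕ → ℝ, ∑ x ∈ Finset.range (N + 1), H x * G (N - x) =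
      ∑ x ∈ Finset.range (N + 1), H (N - x) * G x := by
    intro G H
    rw [← e fun x => H x * G (N - x)]
    refine Finset.sum_congr rfl fun x hx => ?_
    rw [Finset.mem_range] at hx
    rw [show N - (N - x) = x by omega]
  rw [e1 (fun x => f x ^ 2), e1 f] at h1
  refine h1.trans (le_of_eq ?_)
  rw [← Finset.sum_range_reflect]
  refine Finset.sum_congr rfl fun j hj => ?_
  rw [Finset.mem_range] at hj
  rw [h.balance _ (by omega), show N - 1 - j + 1 = N - j by omega,
    show N - (N - j) = j by omega, show N - (N - 1 - j) = j + 1 by omega]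
  ring

/-- A and B are the mean passage times from 0 to the (1 - ε)- and ε-quantiles of w. -/
lemma Rates.exists_passage_bounds (h : Rates N w u d) {γ ε : ℝ} (hP : Poincare N w u γ)
    (hγ : 0 < γ) (hε : 0 < ε) (hε2 : ε ≤ 1 / 2) :
    ∃ A B : ℝ, 0 ≤ B ∧ B ≤ A ∧ A - B ≤ 2 / (ε * γ) ∧
      (∀ t : ℕ, A + √(2 * A / (ε ^ 2 * γ)) < t →
        ∀ k ≤ N, (step u d)^[t] (below k) 0 - cum w k ≤ 2 * ε) ∧
      ∀ t : ℕ, t < B - √(2 * B / (ε ^ 2 * γ)) → ∃ l ≤ N,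
        1 - ε < ∑ x ∈ Finset.range (N + 1), w x * above l x ∧ (step u d)^[t] (above l) 0 ≤ ε := by
  obtain ⟨a, haN, ha, ha'⟩ := h.exists_quantile (α := ε) (by linarith)
  obtain ⟨b, hbN, hb, hb'⟩ := h.exists_quantile (α := 1 - ε) (by linarith)
  have hab : a ≤ b := by
    by_contra! hlt
    have := ha' b hlt
    linarith
  have hm0 : passMean w u 0 = 0 := rfl
  refine ⟨passMean w u b, passMean w u a, hm0 ▸ h.passMean_mono (Nat.zero_le a) haN,
    h.passMean_mono hab hbN, h.passMean_sub_le hP hγ hε haN hbN ha fun j hj => (hb' j hj).le,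
    fun t ht k hk => h.iterate_below_sub_cum_le hP hγ hε (by linarith) hbN hb
      (fun j hj => (hb' j hj).le) ht hk, fun t ht => ⟨a, haN, ?_,
    h.iterate_above_le hP hγ hε haN (fun j hj => by linarith [ha' j hj]) ht⟩⟩
  -- If the ε-quantile is 0 then B = 0 and no time t satisfies the hypothesis.
  rcases a with _ | a
  · have := Real.sqrt_nonneg (2 * passMean w u 0 / (ε ^ 2 * γ))
    rw [hm0] at ht this
    have : (0 : ℝ) ≤ t := t.cast_nonneg
    linarith
  · have e : ∀ x, w x * above (a + 1) x = w x - w x * below a x := by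
      intro x
      simp only [above, below]
      split_ifs <;> first | omega | ring
    simp only [e, Finset.sum_sub_distrib, h.sum_w, sum_mul_below (show a ≤ N by omega)]
    linarith [ha' a (by omega)]

variable {P : Matrix (Fin (N + 1)) (Fin (N + 1)) ℝ} {p : Fin (N + 1) → ℝ}

lemma above_nonneg (k x : ℕ) : 0 ≤ Rates.above k x := by
  simp only [Rates.above]
  split_ifs <;> norm_num

/-- Two pairs of hitting-time scales, one for each end of the segment, that control the
distance to stationarity from above and below. -/
lemma exists_mixing_bounds (hBD : IsBirthDeath P) (hlazy : IsLazy P) (hirr : P.IsIrreducible)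
    (hp : IsStationary P p) {ε : ℝ} (hε : 0 < ε) (hε2 : ε ≤ 1 / 2) :
    ∃ A B : Bool → ℝ, (∀ i, 0 ≤ B i ∧ B i ≤ A i ∧ A i - B i ≤ 2 / (ε * gap P)) ∧
      (∀ t : ℕ, (∀ i, A i + √(2 * A i / (ε ^ 2 * gap P)) < t) → worstDist P p t ≤ 4 * ε) ∧
      ∀ t : ℕ, ∀ i, t < B i - √(2 * B i / (ε ^ 2 * gap P)) → 1 - 2 * ε < worstDist P p t := by
  have h := rates_of_matrix hBD hlazy hirr hp
  have hγ := gap_pos hBD.stochastic hlazy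
  have hP := poincare_gap hBD hp h
  obtain ⟨A, B, h1, h2, h3, h4, h5⟩ := h.exists_passage_bounds hP hγ hε hε2
  obtain ⟨A', B', h1', h2', h3', h4', h5'⟩ :=
    h.reflect.exists_passage_bounds (hP.reflect h) hγ hε hε2
  -- `true` stands for the end 0, `false` for the end N through reflection.
  refine ⟨fun i => cond i A A', fun i => cond i B B', ?_, fun t ht => ?_, fun t => ?_⟩
  · rintro (_ | _)
    exacts [⟨h1', h2', h3'⟩, ⟨h1, h2, h3⟩]
  · have := worstDist_le hBD hp h (h4 t (ht true)) (h4' t (ht false))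
    linarith
  · rintro (_ | _) ht
    · obtain ⟨l, -, hl1, hl2⟩ := h5' t ht
      have h6 := sum_sub_iterate_le_worstDist hBD hp t (f := fun y => Rates.above l (N - y))
        (fun x => above_nonneg _ _) (fun x => Rates.above_le_one _ _) (x := N) le_rfl
      have h7 := h.iterate_reflect t (fun y => Rates.above l (N - y)) 0 (Nat.zero_le N)
      rw [Nat.sub_zero] at h7
      rw [← h7, h.reflect.iterate_congr t (g := Rates.above l)
        (fun x hx => by rw [show N - (N - x) = x by omega]) 0 (Nat.zero_le N)] at h6
      rw [← Finset.sum_range_reflect] at hl1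
      have h8 : ∑ j ∈ Finset.range (N + 1), extend p (N - (N + 1 - 1 - j)) *
          Rates.above l (N + 1 - 1 - j) =
          ∑ y ∈ Finset.range (N + 1), extend p y * Rates.above l (N - y) := by
        refine Finset.sum_congr rfl fun y hy => ?_
        rw [Finset.mem_range] at hy
        rw [Nat.add_sub_cancel, show N - (N - y) = y by omega]
      rw [h8] at hl1
      linarith
    · obtain ⟨l, -, hl1, hl2⟩ := h5 t ht
      have h6 := sum_sub_iterate_le_worstDist hBD hp t (f := Rates.above l)
        (fun x => above_nonneg _ _) (fun x => Rates.above_le_one _ _) (x := 0) (Nat.zero_le N)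
      linarith

/-! ### Basic estimates on mixing times. -/

/-- The bound is attained at some time, so the infimum defining `tmix` is over a nonempty set and is
not the default value 0. -/
lemma worstDist_tmix_le (hBD : IsBirthDeath P) (hlazy : IsLazy P) (hirr : P.IsIrreducible)
    (hp : IsStationary P p) {ε : ℝ} (hε : 0 < ε) : worstDist P p (tmix P p ε) ≤ ε := by
  refine Nat.sInf_mem (s := {t | worstDist P p t ≤ ε}) ?_
  set δ := min (ε / 4) (1 / 2)
  have hδ : 0 < δ := by positivity
  obtain ⟨A, B, -, h, -⟩ := exists_mixing_bounds hBD hlazy hirr hp hδ (min_le_right _ _)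
  obtain ⟨t, ht⟩ := exists_nat_gt (∑ i, |A i + √(2 * A i / (δ ^ 2 * gap P))|)
  refine ⟨t, (h t fun i => ((le_abs_self _).trans ?_).trans_lt ht).trans ?_⟩
  · exact Finset.single_le_sum (f := fun i => |A i + √(2 * A i / (δ ^ 2 * gap P))|)
      (fun _ _ => abs_nonneg _) (Finset.mem_univ i)
  · have : δ ≤ ε / 4 := min_le_left _ _
    linarith

lemma tmix_le {ε : ℝ} {t : ℕ} (h : worstDist P p t ≤ ε) : tmix P p ε ≤ t := Nat.sInf_le h

lemma tmix_anti (hBD : IsBirthDeath P) (hlazy : IsLazy P) (hirr : P.IsIrreducible)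
    (hp : IsStationary P p) {ε δ : ℝ} (hε : 0 < ε) (hεδ : ε ≤ δ) : tmix P p δ ≤ tmix P p ε :=
  tmix_le ((worstDist_tmix_le hBD hlazy hirr hp hε).trans hεδ)

/-- A lazy chain has not left its starting point by time `t` with probability `2⁻ᵗ`. -/
lemma half_pow_sub_le_worstDist (hBD : IsBirthDeath P) (hlazy : IsLazy P)
    (hp : IsStationary P p) (t : ℕ) (x : Fin (N + 1)) :
    (1 / 2) ^ t - p x ≤ worstDist P p t := by
  have h1 : ∀ t : ℕ, (1 / 2 : ℝ) ^ t ≤ (P ^ t) x x := by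
    intro t
    induction t with
    | zero => simp
    | succ t ih =>
      rw [pow_succ, pow_succ, Matrix.mul_apply]
      refine (mul_le_mul ih (hlazy x) (by norm_num) (le_trans (by positivity) ih)).trans ?_
      exact Finset.single_le_sum (f := fun z => (P ^ t) x z * P z x) (fun z _ => mul_nonneg
        ((pow_mem hBD.stochastic t).1 x z) (hBD.stochastic.1 z x)) (Finset.mem_univ x)
  have h2 := sum_mul_sub_le_tv (sum_pow_row hBD hp t x) (f := Pi.single x 1)
    (fun y => by rw [Pi.single_apply]; split_ifs <;> norm_num)
    (fun y => by rw [Pi.single_apply]; split_ifs <;> norm_num)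
  simp only [Pi.single_apply, mul_ite, mul_one, mul_zero, Finset.sum_ite_eq', Finset.mem_univ,
    if_true] at h2
  linarith [h1 t, tv_le_worstDist P p t x]

lemma exists_worstDist_zero_le (hBD : IsBirthDeath P) (hp : IsStationary P p) :
    ∃ x, worstDist P p 0 ≤ 1 - p x := by
  obtain ⟨x, hx⟩ := exists_eq_ciSup_of_finite (f := fun x => tv ((P ^ 0) x) p)
  refine ⟨x, ?_⟩
  rw [worstDist, ← hx, tv_eq_sum_posPart (sum_pow_row hBD hp 0 x), Finset.sum_eq_single x]
  · have : p x ≤ 1 := hp.1.2 ▸ Finset.single_le_sum (fun y _ => hp.1.1 y) (Finset.mem_univ x)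
    simp [this]
  · intro y _ hy
    have := hp.1.1 y
    simp [Matrix.one_apply_ne hy.symm, this]
  · simp

lemma one_le_tmix (hN : 1 ≤ N) (hBD : IsBirthDeath P) (hlazy : IsLazy P)
    (hirr : P.IsIrreducible) (hp : IsStationary P p) : 1 ≤ tmix P p (1 / 4) := by
  by_contra! h0
  have h1 := worstDist_tmix_le hBD hlazy hirr hp (ε := 1 / 4) (by norm_num)
  rw [show tmix P p (1 / 4) = 0 by omega] at h1
  have h2 := half_pow_sub_le_worstDist hBD hlazy hp 0 ⟨0, by omega⟩
  have h3 := half_pow_sub_le_worstDist hBD hlazy hp 0 ⟨1, by omega⟩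
  have h4 : p ⟨0, by omega⟩ + p ⟨1, by omega⟩ ≤ 1 := by
    rw [← hp.1.2, ← Finset.sum_pair (by simp)]
    exact Finset.sum_le_sum_of_subset_of_nonneg (Finset.subset_univ _) fun y _ _ => hp.1.1 y
  simp only [pow_zero] at h2 h3
  linarith

/-- The spectral bound gives lam^T ≤ 1/2 at T = tmix(1/4), and Bernoulli gives lam^T ≥ 1 - T · gap.
Consequently trel ≤ 2 tmix. -/
lemma half_le_tmix_mul_gap (hN : 1 ≤ N) (hBD : IsBirthDeath P) (hlazy : IsLazy P)
    (hirr : P.IsIrreducible) (hp : IsStationary P p) :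
    1 / 2 ≤ (tmix P p (1 / 4) : ℝ) * gap P := by
  have h1 := one_le_tmix hN hBD hlazy hirr hp
  have h2 := lam_pow_le P hp (t := tmix P p (1 / 4)) (by omega)
  have h3 := worstDist_tmix_le hBD hlazy hirr hp (ε := 1 / 4) (by norm_num)
  have h4 := one_add_mul_le_pow (a := -gap P) (by linarith [gap_le_one P]) (tmix P p (1 / 4))
  rw [show 1 + -gap P = lam P by rw [gap]; ring] at h4
  linarith

/-- The mixing-time profile of a birth-and-death chain has width of order at most
`√(tmix * trel)`. -/
theorem exists_tmix_sub_le {ε : ℝ} (hε : 0 < ε) (hε2 : ε < 1 / 2) :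
    ∃ c : ℝ, 0 < c ∧ ∀ {N : ℕ} {P : Matrix (Fin (N + 1)) (Fin (N + 1)) ℝ} {p : Fin (N + 1) → ℝ},
      1 ≤ N → IsBirthDeath P → IsLazy P → P.IsIrreducible → IsStationary P p →
      (tmix P p ε : ℝ) - tmix P p (1 - ε) ≤ c * √(tmix P p (1 / 4) * trel P) := by
  set η := ε / 4 with hη
  have hη0 : 0 < η := by positivity
  -- Chosen so that every upper scale A i is at most κ times tmix(1/4).
  set κ := 2 + 4 / η ^ 2 + 4 / η with hκ
  have hκ0 : 0 < κ := by positivity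
  refine ⟨4 / η + 2 * √(2 * κ / η ^ 2) + 1, by positivity, ?_⟩
  intro N P p hN hBD hlazy hirr hp
  obtain ⟨A, B, hAB, hup, hlow⟩ := exists_mixing_bounds hBD hlazy hirr hp hη0 (by linarith)
  have hγ := gap_pos hBD.stochastic hlazy
  have hT1 : (1 : ℝ) ≤ tmix P p (1 / 4) := by
    exact_mod_cast one_le_tmix hN hBD hlazy hirr hp
  have hTγ := half_le_tmix_mul_gap hN hBD hlazy hirr hp
  have hτT : (tmix P p (1 - ε) : ℝ) ≤ tmix P p (1 / 4) := by
    exact_mod_cast tmix_anti hBD hlazy hirr hp (by norm_num) (by linarith)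
  have hdlow := worstDist_tmix_le hBD hlazy hirr hp (ε := 1 - ε) (by linarith)
  set γ := gap P with hγdef
  set g := trel P with hg
  have hgγ : g = γ⁻¹ := rfl
  set T : ℝ := ((tmix P p (1 / 4) : ℕ) : ℝ) with hT
  set τ := tmix P p (1 - ε) with hτ
  have hg1 : 1 ≤ g := by rw [hgγ]; exact (one_le_inv₀ hγ).2 (gap_le_one P)
  have hgT : g ≤ 2 * T := by
    rw [hgγ, inv_le_iff_one_le_mul₀ hγ]
    linarith
  set D := √(T * g) with hD
  have hD2 : D ^ 2 = T * g := Real.sq_sqrt (by positivity)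
  have hD0 : 0 ≤ D := Real.sqrt_nonneg _
  -- Lets D absorb the rounding error 1 from passing to integer times.
  have hD1 : 1 ≤ D := by
    rw [hD, Real.one_le_sqrt]
    nlinarith
  have hgD : g ≤ 2 * D := by
    refine le_of_sq_le_sq ?_ (by positivity)
    nlinarith
  have key : ∀ i, A i + √(2 * A i / (η ^ 2 * γ)) + 1 - τ ≤
      (4 / η + 2 * √(2 * κ / η ^ 2) + 1) * D := by
    intro i
    obtain ⟨hB0, hBA, hdiff⟩ := hAB i
    have e : ∀ z, 2 * z / (η ^ 2 * γ) = 2 * z * g / η ^ 2 := by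
      intro z; rw [hgγ]; field_simp
    have hdiff' : A i - B i ≤ 2 / η * g := by
      refine hdiff.trans (le_of_eq ?_)
      rw [hgγ]; field_simp
    -- Otherwise the distance at time τ would exceed 1 - 2η, hence 1 - ε since ε = 4η.
    have hBτ : B i - √(2 * B i / (η ^ 2 * γ)) ≤ τ := by
      by_contra! hlt
      have := hlow τ i hlt
      linarith
    -- AM–GM; it turns `hBτ` into B ≤ 2τ + 2g/η².
    have hsB : √(2 * B i / (η ^ 2 * γ)) ≤ B i / 2 + g / η ^ 2 := by
      rw [e]
      refine Real.sqrt_le_iff.2 ⟨by positivity, ?_⟩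
      have : 2 * B i * g / η ^ 2 = 4 * (B i / 2) * (g / η ^ 2) := by ring
      rw [this]
      nlinarith [sq_nonneg (B i / 2 - g / η ^ 2)]
    have hAκ : A i ≤ κ * T := by
      have h1 : g / η ^ 2 ≤ 2 * T / η ^ 2 := by gcongr
      have h2 : 2 / η * g ≤ 2 / η * (2 * T) := by gcongr
      have h3 : κ * T = 2 * T + 2 * (2 * T / η ^ 2) + 2 / η * (2 * T) := by rw [hκ]; ring
      linarith
    have hsA : √(2 * A i / (η ^ 2 * γ)) ≤ √(2 * κ / η ^ 2) * D := by
      rw [e, hD, ← Real.sqrt_mul (by positivity)]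
      refine Real.sqrt_le_sqrt ?_
      have : 2 * κ / η ^ 2 * (T * g) = 2 * (κ * T) * g / η ^ 2 := by ring
      rw [this]
      gcongr
    have hsBA : √(2 * B i / (η ^ 2 * γ)) ≤ √(2 * A i / (η ^ 2 * γ)) := by
      refine Real.sqrt_le_sqrt ?_
      gcongr
    have h4 : 2 / η * g ≤ 2 / η * (2 * D) := by gcongr
    have h5 : (4 / η + 2 * √(2 * κ / η ^ 2) + 1) * D =
        2 / η * (2 * D) + 2 * (√(2 * κ / η ^ 2) * D) + D := by ring
    linarith
  obtain ⟨i, hi⟩ := Finite.exists_max fun i => A i + √(2 * A i / (η ^ 2 * γ))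
  have hA0 : 0 ≤ A i := (hAB i).1.trans (hAB i).2.1
  have h6 := hup (⌊A i + √(2 * A i / (η ^ 2 * γ))⌋₊ + 1) fun j =>
    (hi j).trans_lt (by exact_mod_cast Nat.lt_floor_add_one _)
  have h7 : tmix P p ε ≤ ⌊A i + √(2 * A i / (η ^ 2 * γ))⌋₊ + 1 :=
    tmix_le (h6.trans (by rw [hη]; linarith))
  have h8 : (tmix P p ε : ℝ) ≤ ⌊A i + √(2 * A i / (η ^ 2 * γ))⌋₊ + 1 := by exact_mod_cast h7
  have h9 := Nat.floor_le (a := A i + √(2 * A i / (η ^ 2 * γ))) (by positivity)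
  linarith [key i]

end Window

/-! ### Cutoff, the product condition and the window. -/

section Cutoff

variable {N : ℕ → ℕ} {P : (n : ℕ) → Matrix (Fin (N n + 1)) (Fin (N n + 1)) ℝ}
  {p : (n : ℕ) → Fin (N n + 1) → ℝ}

lemma sqrt_tmix_mul_trel_div_tendsto
    (h : Tendsto (fun n => (tmix (P n) (p n) (1 / 4) : ℝ) * gap (P n)) atTop atTop) :
    Tendsto (fun n => √((tmix (P n) (p n) (1 / 4) : ℝ) * trel (P n)) / tmix (P n) (p n) (1 / 4))
      atTop (𝓝 0) := by
  have h1 : Tendsto (fun n => √(((tmix (P n) (p n) (1 / 4) : ℝ) * gap (P n))⁻¹)) atTop (𝓝 0) := by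
    have := (Real.continuous_sqrt.tendsto 0).comp h.inv_tendsto_atTop
    rwa [Real.sqrt_zero] at this
  refine h1.congr' ?_
  filter_upwards [h.eventually_gt_atTop 0] with n hn
  have hT : (0 : ℝ) < tmix (P n) (p n) (1 / 4) :=
    lt_of_le_of_ne (Nat.cast_nonneg _) fun h0 => by rw [← h0, zero_mul] at hn; exact hn.false
  rw [eq_div_iff hT.ne', ← Real.sqrt_sq hT.le, ← Real.sqrt_mul (inv_nonneg.2 (by
    rw [Real.sqrt_sq hT.le]; exact hn.le)), Real.sqrt_sq hT.le]
  congr 1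
  rw [trel, mul_inv]
  field_simp

/-- A large product of mixing time and gap forces all mixing times to be asymptotically equal. -/
lemma tendsto_tmix_div (hN : ∀ n, 1 ≤ N n) (hBD : ∀ n, IsBirthDeath (P n))
    (hlazy : ∀ n, IsLazy (P n)) (hirr : ∀ n, (P n).IsIrreducible)
    (hp : ∀ n, IsStationary (P n) (p n))
    (h : Tendsto (fun n => (tmix (P n) (p n) (1 / 4) : ℝ) * gap (P n)) atTop atTop)
    {ε : ℝ} (hε : 0 < ε) (hε1 : ε < 1) :
    Tendsto (fun n => (tmix (P n) (p n) ε : ℝ) / tmix (P n) (p n) (1 / 4)) atTop (𝓝 1) := by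
  -- Both ε and 1/4 lie in [δ, 1 - δ], so the two mixing times differ by at most the width of the
  -- profile at δ.
  set δ := min (1 / 4) (min ε (1 - ε)) with hδ
  have hδ0 : 0 < δ := lt_min (by norm_num) (lt_min hε (by linarith))
  have hδ4 : δ ≤ 1 / 4 := min_le_left _ _
  have hδε : δ ≤ ε := (min_le_right _ _).trans (min_le_left _ _)
  have hδε' : δ ≤ 1 - ε := (min_le_right _ _).trans (min_le_right _ _)
  obtain ⟨c, hc, hw⟩ := exists_tmix_sub_le hδ0 (by linarith)
  have h0 := (sqrt_tmix_mul_trel_div_tendsto h).const_mul c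
  rw [mul_zero] at h0
  have hlo : Tendsto (fun n => 1 - c * (√((tmix (P n) (p n) (1 / 4) : ℝ) * trel (P n)) /
      tmix (P n) (p n) (1 / 4))) atTop (𝓝 1) := by simpa using h0.const_sub 1
  have hhi : Tendsto (fun n => 1 + c * (√((tmix (P n) (p n) (1 / 4) : ℝ) * trel (P n)) /
      tmix (P n) (p n) (1 / 4))) atTop (𝓝 1) := by simpa using h0.const_add 1
  have anti := fun n {a b : ℝ} (ha : 0 < a) (hab : a ≤ b) =>
    (Nat.cast_le (α := ℝ)).2 (tmix_anti (hBD n) (hlazy n) (hirr n) (hp n) ha hab)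
  have hT : ∀ n, (1 : ℝ) ≤ tmix (P n) (p n) (1 / 4) := fun n => by
    exact_mod_cast one_le_tmix (hN n) (hBD n) (hlazy n) (hirr n) (hp n)
  refine tendsto_of_tendsto_of_tendsto_of_le_of_le hlo hhi (fun n => ?_) (fun n => ?_)
  · have hT0 : (0 : ℝ) < tmix (P n) (p n) (1 / 4) := one_pos.trans_le (hT n)
    have h1 := hw (hN n) (hBD n) (hlazy n) (hirr n) (hp n)
    have h2 := anti n hδ0 hδ4
    have h3 := anti n hε (show ε ≤ 1 - δ by linarith)
    simp only
    rw [le_div_iff₀ hT0, sub_mul, mul_assoc, div_mul_cancel₀ _ hT0.ne']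
    linarith
  · have hT0 : (0 : ℝ) < tmix (P n) (p n) (1 / 4) := one_pos.trans_le (hT n)
    have h1 := hw (hN n) (hBD n) (hlazy n) (hirr n) (hp n)
    have h2 := anti n (a := 1 / 4) (b := 1 - δ) (by norm_num) (by linarith)
    have h3 := anti n hδ0 hδε
    simp only
    rw [div_le_iff₀ hT0, add_mul, mul_assoc, div_mul_cancel₀ _ hT0.ne']
    linarith

lemma hasCutoff_of_tendsto (hN : ∀ n, 1 ≤ N n) (hBD : ∀ n, IsBirthDeath (P n))
    (hlazy : ∀ n, IsLazy (P n)) (hirr : ∀ n, (P n).IsIrreducible)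
    (hp : ∀ n, IsStationary (P n) (p n))
    (h : Tendsto (fun n => (tmix (P n) (p n) (1 / 4) : ℝ) * gap (P n)) atTop atTop) :
    HasCutoff (fun n => tmix (P n) (p n)) := by
  intro ε hε hε1
  have h1 := tendsto_tmix_div hN hBD hlazy hirr hp h hε hε1
  have h2 := tendsto_tmix_div hN hBD hlazy hirr hp h (ε := 1 - ε) (by linarith) (by linarith)
  have h3 := h1.div h2 one_ne_zero
  rw [div_one] at h3
  refine h3.congr fun n => ?_
  have hT : (tmix (P n) (p n) (1 / 4) : ℝ) ≠ 0 := by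
    have := one_le_tmix (hN n) (hBD n) (hlazy n) (hirr n) (hp n)
    exact_mod_cast (show tmix (P n) (p n) (1 / 4) ≠ 0 by omega)
  exact div_div_div_cancel_right₀ hT _ _

lemma exp_neg_two_mul_le {x : ℝ} (hx : 0 ≤ x) (hx2 : x ≤ 1 / 2) : Real.exp (-(2 * x)) ≤ 1 - x := by
  rw [Real.exp_neg, inv_le_comm₀ (Real.exp_pos _) (by linarith)]
  refine le_trans ?_ (Real.add_one_le_exp (2 * x))
  rw [inv_le_iff_one_le_mul₀ (by linarith)]
  nlinarith

/-- The bound 1 - x ≥ exp(-2x) holds only for x ≤ 1/2. A larger gap may make the spectral bound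
useless, but then tmix is bounded in terms of C and laziness supplies the lower bound on the
distance. -/
lemma tendsto_of_hasCutoff (hBD : ∀ n, IsBirthDeath (P n)) (hlazy : ∀ n, IsLazy (P n)) (hirr : ∀ n, (P n).IsIrreducible)
    (hp : ∀ n, IsStationary (P n) (p n)) (hcut : HasCutoff (fun n => tmix (P n) (p n))) :
    Tendsto (fun n => (tmix (P n) (p n) (1 / 4) : ℝ) * gap (P n)) atTop atTop := by
  rw [tendsto_atTop]
  intro C
  -- With s = tmix(ε) ≤ 2T and T · gap < |C|, the spectral bound reads 4ε ≤ lam^s ≤ 2ε.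
  set ε := Real.exp (-(4 * |C|)) / 4 with hε
  have hexp : Real.exp (-(4 * |C|)) ≤ 1 := Real.exp_le_one_iff.2 (by linarith [abs_nonneg C])
  have hε0 : 0 < ε := by positivity
  have hε4 : ε ≤ 1 / 4 := by linarith
  have hev := (hcut ε hε0 (by linarith)).eventually (Ioo_mem_nhds (show (0 : ℝ) < 1 by norm_num)
    (show (1 : ℝ) < 2 by norm_num))
  filter_upwards [hev] with n hn
  by_contra! hlt
  have hst := (hBD n).stochastic
  have hγ := gap_pos hst (hlazy n)
  set T : ℝ := ((tmix (P n) (p n) (1 / 4) : ℕ) : ℝ) with hT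
  have hC := hlt.trans_le (le_abs_self C)
  -- Division by zero gives 0, which lies outside the interval (0, 2).
  have hτ0 : tmix (P n) (p n) (1 - ε) ≠ 0 := by
    intro h0
    rw [h0] at hn
    simp at hn
  have hτpos : (0 : ℝ) < tmix (P n) (p n) (1 - ε) := by exact_mod_cast Nat.pos_of_ne_zero hτ0
  have hτT : (tmix (P n) (p n) (1 - ε) : ℝ) ≤ T := by
    exact Nat.cast_le.2
      (tmix_anti (hBD n) (hlazy n) (hirr n) (hp n) (by norm_num) (by linarith))
  set s := tmix (P n) (p n) ε with hs
  have hsT : (s : ℝ) ≤ 2 * T := by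
    have := (div_lt_iff₀ hτpos).1 hn.2
    linarith
  have hs0 : s ≠ 0 := by
    intro h0
    rw [h0] at hn
    simp at hn
  have hds := worstDist_tmix_le (hBD n) (hlazy n) (hirr n) (hp n) hε0
  rcases le_or_gt (gap (P n)) (1 / 2) with hg | hg
  · have h1 := lam_pow_le (P n) (hp n) hs0
    have h2 : lam (P n) = 1 - gap (P n) := by rw [gap]; ring
    have h3 := pow_le_pow_left₀ (Real.exp_pos _).le (exp_neg_two_mul_le hγ.le hg) s
    rw [← Real.exp_nat_mul, ← h2] at h3
    have h4 : Real.exp (-(4 * |C|)) ≤ Real.exp (s * -(2 * gap (P n))) := by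
      refine Real.exp_le_exp.2 ?_
      nlinarith
    linarith [Real.exp_pos (-(4 * |C|))]
  -- Since tmix(1 - ε) > 0, some state has mass below ε. The chain is still there at time s ≤ 4|C|
  -- with probability at least 2^(-s) ≥ exp(-s) ≥ 4ε, so the distance exceeds 3ε.
  · obtain ⟨x, hx⟩ := exists_worstDist_zero_le (hBD n) (hp n)
    have hpx : p n x < ε := by
      by_contra! hge
      exact hτ0 (Nat.le_zero.1 (tmix_le (by linarith)))
    have h1 := half_pow_sub_le_worstDist (hBD n) (hlazy n) (hp n) s x
    have h3 := pow_le_pow_left₀ (Real.exp_pos _).le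
      (exp_neg_two_mul_le (x := 1 / 2) (by norm_num) le_rfl) s
    rw [← Real.exp_nat_mul, show (1 : ℝ) - 1 / 2 = 1 / 2 by norm_num] at h3
    have h4 : Real.exp (-(4 * |C|)) ≤ Real.exp (s * -(2 * (1 / 2))) := by
      refine Real.exp_le_exp.2 ?_
      nlinarith
    linarith [Real.exp_pos (-(4 * |C|))]

lemma isCutoffWindow_of_tendsto (hN : ∀ n, 1 ≤ N n) (hBD : ∀ n, IsBirthDeath (P n))
    (hlazy : ∀ n, IsLazy (P n)) (hirr : ∀ n, (P n).IsIrreducible)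
    (hp : ∀ n, IsStationary (P n) (p n))
    (h : Tendsto (fun n => (tmix (P n) (p n) (1 / 4) : ℝ) * gap (P n)) atTop atTop) :
    IsCutoffWindow (fun n => tmix (P n) (p n))
      (fun n => √((tmix (P n) (p n) (1 / 4) : ℝ) * trel (P n))) := by
  refine ⟨(isLittleO_iff_tendsto fun n hn => ?_).2 (sqrt_tmix_mul_trel_div_tendsto h),
    fun ε hε hε1 => ?_⟩
  · rw [hn, zero_mul, Real.sqrt_zero]
  rcases lt_or_ge ε (1 / 2) with hε2 | hε2
  · obtain ⟨c, hc, hw⟩ := exists_tmix_sub_le hε hε2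
    exact ⟨c, hc, fun n => hw (hN n) (hBD n) (hlazy n) (hirr n) (hp n)⟩
  -- For ε ≥ 1/2 the difference of mixing times is nonpositive, so any constant works.
  · refine ⟨1, one_pos, fun n => ?_⟩
    have h1 : (tmix (P n) (p n) ε : ℝ) ≤ tmix (P n) (p n) (1 - ε) := by
      exact_mod_cast tmix_anti (hBD n) (hlazy n) (hirr n) (hp n) (by linarith) (by linarith)
    have h2 := Real.sqrt_nonneg ((tmix (P n) (p n) (1 / 4) : ℝ) * trel (P n))
    linarith

end Cutoff

end BDChain

theorem corollary1 (N : ℕ → ℕ) (hN : ∀ n, 1 ≤ N n)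
    (P : (n : ℕ) → Matrix (Fin (N n + 1)) (Fin (N n + 1)) ℝ)
    (hBD : ∀ n, BDChain.IsBirthDeath (P n))
    (hlazy : ∀ n, BDChain.IsLazy (P n))
    (hirr : ∀ n, (P n).IsIrreducible)
    (p : (n : ℕ) → Fin (N n + 1) → ℝ)
    (hp : ∀ n, BDChain.IsStationary (P n) (p n)) :
    (BDChain.HasCutoff (fun n => BDChain.tmix (P n) (p n)) ↔
      Tendsto (fun n => (BDChain.tmix (P n) (p n) (1 / 4) : ℝ) * BDChain.gap (P n))
        atTop atTop) ∧
    (BDChain.HasCutoff (fun n => BDChain.tmix (P n) (p n)) →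
      BDChain.IsCutoffWindow (fun n => BDChain.tmix (P n) (p n))
        (fun n => √((BDChain.tmix (P n) (p n) (1 / 4) : ℝ) * BDChain.trel (P n)))) :=
  ⟨⟨BDChain.tendsto_of_hasCutoff hBD hlazy hirr hp,
    BDChain.hasCutoff_of_tendsto hN hBD hlazy hirr hp⟩, fun h =>
    BDChain.isCutoffWindow_of_tendsto hN hBD hlazy hirr hp
      (BDChain.tendsto_of_hasCutoff hBD hlazy hirr hp h)⟩
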